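/- **Setting.** Presburger arithmetic (PA) is interpreted over the integers. Terms are built from variables, $0$, $1$, unary $-$ and $+$; for $c>0$ the constant $c$ abbreviates $1+\dots+1$, and $k\cdot x$ abbreviates $x+\dots+x$. Atomic formulas are $t_1\bowtie t_2$ with $\bowtie\in\{=,\neq,<,\le,>,\ge\}$ and $d\mid t$ with $d\ge 2$; formulas are built from these with $\neg,\wedge,\vee,\rightarrow,\leftrightarrow,\exists x,\forall x$. Two formulas are logically equivalent if they have the same truth value in $\mathbb Z$ under every assignment. The *length* of a formula is its number of letters, where a variable is one letter, abbreviations are expanded, parentheses are not counted, and $d\mid t$ has the length of $t$ plus $d+1$. Every atomic formula is brought into its *normalized form*: $t\bowtie c$ resp. $d\mid t+c$, with $c\in\mathbb Z$ and $t$ *homogeneous*, i.e. $t=0$ or $t=k_1\cdot x_1+\dots+k_r\cdot x_r$ with pairwise distinct variables and nonzero coefficients (for $t_1\bowtie t_2$ the variables are collected on the left and the constants on the right). Homogeneous terms with the same coefficients are identified. With respect to the normalized atomic formulas of $\varphi$, let - $\mathsf T(\varphi)$ be the set of the terms $t$ with some (in)equation $t\bowtie c$ occurring, and $\mathsf D(\varphi)$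 the set of the $d\mid t$ with some $d\mid t+c$ occurring; - $\mathrm{max_{coef}}(\varphi)$ and $\mathrm{max_{const}}(\varphi)$ be the maximum of $1$ and of the absolute values of the coefficients, respectively of the constants $c$, in the (in)equations $t\bowtie c$; - $\mathrm{max_{div}}(\varphi)$ be the maximum of $1$ and of the divisors $d$ in the atoms $d\mid t+c$. Let $\mathrm{qn}(\varphi)$ be the number of quantifiers occurring in $\varphi$. For $Q\in\{\exists,\forall\}$ with dual $\overline Q$, define $\mathrm{qa}_Q$ and $\mathrm{qbl}_Q$ to be $0$ on atomic formulas; to satisfy $f_Q(\neg\psi)=f_{\overline Q}(\psi)$ for $f\in\{\mathrm{qa},\mathrm{qbl}\}$; to be the maximum (for $\mathrm{qa}_Q$), respectively the sum (for $\mathrm{qbl}_Q$), of the values of the two parts on $\psi_1\wedge\psi_2$ and $\psi_1\vee\psi_2$; to treat $\psi_1\rightarrow\psi_2$ as $\neg\psi_1\vee\psi_2$ and $\psi_1\leftrightarrow\psi_2$ as $(\psi_1\rightarrow\psi_2)\wedge(\psi_2\rightarrow\psi_1)$; and on quantified formulas $$\mathrm{qa}_Q(Qx\,\psi)=\max\{1,\mathrm{qa}_Q(\psi)\},\qquad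 \mathrm{qa}_Q(\overline Qx\,\psi)=1+\mathrm{qa}_{\overline Q}(\overline Qx\,\psi),$$ $$\mathrm{qbl}_Q(Qx\,\psi)=1+\mathrm{qbl}_Q(\psi),\qquad \mathrm{qbl}_Q(\overline Qx\,\psi)=0.$$ Finally $\mathrm{qa}(\varphi)=\min\{\mathrm{qa}_\exists(\varphi),\mathrm{qa}_\forall(\varphi)\}$ (for a prenex formula, the number of its quantifier blocks), and $\mathrm{qbl}(\varphi)$ is the maximum of $\mathrm{qbl}_Q(\psi)$ over $Q\in\{\exists,\forall\}$ and all subformulas $\psi$ of $\varphi$. **Theorem.** For every PA formula $\varphi$ of length $n$ there is a logically equivalent quantifier-free formula $\psi$ such that $$|\mathsf T(\psi)|\le n^{(\mathrm{qbl}(\varphi)+1)^{\mathrm{qa}(\varphi)}},\qquad |\mathsf D(\psi)|\le n^{1+(\mathrm{qbl}(\varphi)+1)^{\mathrm{qa}(\varphi)+2}},$$ and, for all real $a>\max\{2,\mathrm{max_{coef}}(\varphi),\mathrm{max_{div}}(\varphi)\}$ and $b>\max\{2,\mathrm{max_{const}}(\varphi)\}$, $$\mathrm{max_{coef}}(\psi)<a^{2^{2\,\mathrm{qn}(\varphi)}},\qquad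 \mathrm{max_{div}}(\psi)<a^{2^{2\,\mathrm{qn}(\varphi)}},\qquad \mathrm{max_{const}}(\psi)<b\cdot a^{2^{3\,\mathrm{qn}(\varphi)}\cdot n^{1+(\mathrm{qbl}(\varphi)+1)^{\mathrm{qa}(\varphi)+2}}}.$$ -/

import Mathlib

namespace PA

/-- Terms of the extended language of Presburger arithmetic; the variables are indexed by `ℕ`. -/
inductive Term : Type
  | var (x : ℕ)
  | zero
  | one
  | neg (t : Term)
  | add (t₁ t₂ : Term)
  deriving DecidableEq

/-- The relation symbols of (in)equations: `=`, `≠`, `<`, `≤`, `>`, `≥`. -/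
inductive Rel : Type
  | eq | ne | lt | le | gt | ge
  deriving DecidableEq

/-- The two quantifiers. -/
inductive Quant : Type
  | ex | all
  deriving DecidableEq

/-- Formulas of the extended language of Presburger arithmetic. The divisibility predicates
`d ∣` are present for `d ≥ 2` only. -/
inductive Formula : Type
  | rel (r : Rel) (t₁ t₂ : Term)
  | dvd (d : ℕ) (hd : 2 ≤ d) (t : Term)
  | not (φ : Formula)
  | and (φ₁ φ₂ : Formula)
  | or (φ₁ φ₂ : Formula)
  | imp (φ₁ φ₂ : Formula)
  | iff (φ₁ φ₂ : Formula)
  | quant (Q : Quant) (x : ℕ) (φ : Formula)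
  deriving DecidableEq

/-! ### Semantics over the integers -/

/-- The value of a term under an assignment of integers to the variables. -/
def Term.eval (v : ℕ → ℤ) : Term → ℤ
  | .var x => v x
  | .zero => 0
  | .one => 1
  | .neg t => -t.eval v
  | .add t₁ t₂ => t₁.eval v + t₂.eval v

/-- The interpretation of the relation symbols. -/
def Rel.Holds : Rel → ℤ → ℤ → Prop
  | .eq, a, b => a = b
  | .ne, a, b => a ≠ b
  | .lt, a, b => a < b
  | .le, a, b => a ≤ b
  | .gt, a, b => a > b
  | .ge, a, b => a ≥ b

/-- Truth of a formula in the integers under an assignment. -/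
def Formula.Holds : Formula → (ℕ → ℤ) → Prop
  | .rel r t₁ t₂, v => r.Holds (t₁.eval v) (t₂.eval v)
  | .dvd d _ t, v => (d : ℤ) ∣ t.eval v
  | .not φ, v => ¬ φ.Holds v
  | .and φ₁ φ₂, v => φ₁.Holds v ∧ φ₂.Holds v
  | .or φ₁ φ₂, v => φ₁.Holds v ∨ φ₂.Holds v
  | .imp φ₁ φ₂, v => φ₁.Holds v → φ₂.Holds v
  | .iff φ₁ φ₂, v => φ₁.Holds v ↔ φ₂.Holds v
  | .quant .ex x φ, v => ∃ a : ℤ, φ.Holds (Function.update v x a)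
  | .quant .all x φ, v => ∀ a : ℤ, φ.Holds (Function.update v x a)

/-- Logical equivalence: the same truth value under every assignment. -/
def Formula.Equivalent (φ ψ : Formula) : Prop :=
  ∀ v : ℕ → ℤ, φ.Holds v ↔ ψ.Holds v

/-- A formula is quantifier-free. -/
def Formula.IsQF : Formula → Prop
  | .rel _ _ _ => True
  | .dvd _ _ _ => True
  | .not φ => φ.IsQF
  | .and φ₁ φ₂ => φ₁.IsQF ∧ φ₂.IsQF
  | .or φ₁ φ₂ => φ₁.IsQF ∧ φ₂.IsQF
  | .imp φ₁ φ₂ => φ₁.IsQF ∧ φ₂.IsQF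
  | .iff φ₁ φ₂ => φ₁.IsQF ∧ φ₂.IsQF
  | .quant _ _ _ => False

/-! ### Length -/

/-- Number of letters of a term. Every variable is one letter and parentheses are not counted.
The integer constant `c > 0` is the term `1 + ⋯ + 1` and `k · x` is `x + ⋯ + x`, so that
integers are measured linearly. -/
def Term.length : Term → ℕ
  | .var _ => 1
  | .zero => 1
  | .one => 1
  | .neg t => 1 + t.length
  | .add t₁ t₂ => t₁.length + 1 + t₂.length

/-- Number of letters of a formula, where `d ∣ t` has the length of `t` plus `d + 1`.
Parentheses are not counted. -/
def Formula.length : Formula → ℕ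
  | .rel _ t₁ t₂ => t₁.length + 1 + t₂.length
  | .dvd d _ t => t.length + (d + 1)
  | .not φ => 1 + φ.length
  | .and φ₁ φ₂ => φ₁.length + 1 + φ₂.length
  | .or φ₁ φ₂ => φ₁.length + 1 + φ₂.length
  | .imp φ₁ φ₂ => φ₁.length + 1 + φ₂.length
  | .iff φ₁ φ₂ => φ₁.length + 1 + φ₂.length
  | .quant _ _ φ => 2 + φ.length

/-! ### Quantifier number, quantifier alternations, quantifier block length -/

/-- The dual quantifier. -/
def Quant.dual : Quant → Quant
  | .ex => .all
  | .all => .ex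

/-- The quantifier number. -/
def Formula.qn : Formula → ℕ
  | .rel _ _ _ => 0
  | .dvd _ _ _ => 0
  | .not φ => φ.qn
  | .and φ₁ φ₂ => φ₁.qn + φ₂.qn
  | .or φ₁ φ₂ => φ₁.qn + φ₂.qn
  | .imp φ₁ φ₂ => φ₁.qn + φ₂.qn
  | .iff φ₁ φ₂ => φ₁.qn + φ₂.qn
  | .quant _ _ φ => 1 + φ.qn

/-- Number of quantifier alternations relative to a leading quantifier `Q` (a leading block of
quantifiers `Q` is counted also when it is empty). An implication is read as `¬ φ₁ ∨ φ₂`, an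
equivalence as the conjunction of the two implications. -/
def Formula.qaQ : Formula → Quant → ℕ
  | .rel _ _ _, _ => 0
  | .dvd _ _ _, _ => 0
  | .not φ, Q => φ.qaQ Q.dual
  | .and φ₁ φ₂, Q => max (φ₁.qaQ Q) (φ₂.qaQ Q)
  | .or φ₁ φ₂, Q => max (φ₁.qaQ Q) (φ₂.qaQ Q)
  | .imp φ₁ φ₂, Q => max (φ₁.qaQ Q.dual) (φ₂.qaQ Q)
  | .iff φ₁ φ₂, Q =>
      max (max (φ₁.qaQ Q.dual) (φ₂.qaQ Q)) (max (φ₂.qaQ Q.dual) (φ₁.qaQ Q))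
  | .quant Q' _ φ, Q =>
      if Q' = Q then max 1 (φ.qaQ Q) else 1 + max 1 (φ.qaQ Q.dual)

/-- The number of quantifier alternations. For a formula in prenex normal form this is the
number of its quantifier blocks. -/
def Formula.qa (φ : Formula) : ℕ := min (φ.qaQ .ex) (φ.qaQ .all)

/-- Quantifier block length relative to the quantifier `Q`. -/
def Formula.qblQ : Formula → Quant → ℕ
  | .rel _ _ _, _ => 0
  | .dvd _ _ _, _ => 0
  | .not φ, Q => φ.qblQ Q.dual
  | .and φ₁ φ₂, Q => φ₁.qblQ Q + φ₂.qblQ Q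
  | .or φ₁ φ₂, Q => φ₁.qblQ Q + φ₂.qblQ Q
  | .imp φ₁ φ₂, Q => φ₁.qblQ Q.dual + φ₂.qblQ Q
  | .iff φ₁ φ₂, Q => (φ₁.qblQ Q.dual + φ₂.qblQ Q) + (φ₂.qblQ Q.dual + φ₁.qblQ Q)
  | .quant Q' _ φ, Q => if Q' = Q then 1 + φ.qblQ Q else 0

theorem Formula.qaQ_imp (φ₁ φ₂ : Formula) (Q : Quant) :
    (Formula.imp φ₁ φ₂).qaQ Q = (Formula.or (.not φ₁) φ₂).qaQ Q := rfl

theorem Formula.qaQ_iff (φ₁ φ₂ : Formula) (Q : Quant) :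
    (Formula.iff φ₁ φ₂).qaQ Q = (Formula.and (.imp φ₁ φ₂) (.imp φ₂ φ₁)).qaQ Q := rfl

theorem Formula.qaQ_quant_self (x : ℕ) (φ : Formula) (Q : Quant) :
    (Formula.quant Q x φ).qaQ Q = max 1 (φ.qaQ Q) := by
  simp [Formula.qaQ]

theorem Formula.qaQ_quant_dual (x : ℕ) (φ : Formula) (Q : Quant) :
    (Formula.quant Q.dual x φ).qaQ Q = 1 + (Formula.quant Q.dual x φ).qaQ Q.dual := by
  cases Q <;> simp [Formula.qaQ, Quant.dual]

theorem Formula.qblQ_imp (φ₁ φ₂ : Formula) (Q : Quant) :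
    (Formula.imp φ₁ φ₂).qblQ Q = (Formula.or (.not φ₁) φ₂).qblQ Q := rfl

theorem Formula.qblQ_iff (φ₁ φ₂ : Formula) (Q : Quant) :
    (Formula.iff φ₁ φ₂).qblQ Q = (Formula.and (.imp φ₁ φ₂) (.imp φ₂ φ₁)).qblQ Q := rfl

/-- The set of subformulas of a formula (the formula itself included). -/
def Formula.subformulas : Formula → Finset Formula
  | .rel r t₁ t₂ => {.rel r t₁ t₂}
  | .dvd d hd t => {.dvd d hd t}
  | .not φ => insert (.not φ) φ.subformulas
  | .and φ₁ φ₂ => insert (.and φ₁ φ₂) (φ₁.subformulas ∪ φ₂.subformulas)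
  | .or φ₁ φ₂ => insert (.or φ₁ φ₂) (φ₁.subformulas ∪ φ₂.subformulas)
  | .imp φ₁ φ₂ => insert (.imp φ₁ φ₂) (φ₁.subformulas ∪ φ₂.subformulas)
  | .iff φ₁ φ₂ => insert (.iff φ₁ φ₂) (φ₁.subformulas ∪ φ₂.subformulas)
  | .quant Q x φ => insert (.quant Q x φ) φ.subformulas

/-- The quantifier block length. -/
def Formula.qbl (φ : Formula) : ℕ :=
  φ.subformulas.sup fun ψ => max (ψ.qblQ .ex) (ψ.qblQ .all)

/-! ### Normalized atomic formulas and the parameters of a formula -/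

/-- A homogeneous term `k₁ · x₁ + ⋯ + k_r · x_r`, given by its coefficient function. -/
abbrev HomTerm : Type := ℕ →₀ ℤ

/-- Normalized atomic formulas: `t ⋈ c` and `d ∣ t + c` with `t` homogeneous. -/
inductive NormAtom : Type
  | rel (r : Rel) (t : HomTerm) (c : ℤ)
  | dvd (d : ℕ) (t : HomTerm) (c : ℤ)
  deriving DecidableEq

/-- The homogeneous part of a term. -/
noncomputable def Term.hom : Term → HomTerm
  | .var x => Finsupp.single x 1
  | .zero => 0
  | .one => 0
  | .neg t => -t.hom
  | .add t₁ t₂ => t₁.hom + t₂.hom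

/-- The sum of the constants of a term. -/
def Term.const : Term → ℤ
  | .var _ => 0
  | .zero => 0
  | .one => 1
  | .neg t => -t.const
  | .add t₁ t₂ => t₁.const + t₂.const

/-- The set of the normalized forms of the atomic formulas occurring in a formula: in an
(in)equation the variables are collected on the left-hand side and the constants on the
right-hand side. -/
noncomputable def Formula.atoms : Formula → Finset NormAtom
  | .rel r t₁ t₂ => {.rel r (t₁.hom - t₂.hom) (t₂.const - t₁.const)}
  | .dvd d _ t => {.dvd d t.hom t.const}
  | .not φ => φ.atoms
  | .and φ₁ φ₂ => φ₁.atoms ∪ φ₂.atoms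
  | .or φ₁ φ₂ => φ₁.atoms ∪ φ₂.atoms
  | .imp φ₁ φ₂ => φ₁.atoms ∪ φ₂.atoms
  | .iff φ₁ φ₂ => φ₁.atoms ∪ φ₂.atoms
  | .quant _ _ φ => φ.atoms

/-- The homogeneous terms of the (in)equations of a formula. -/
noncomputable def Formula.homTerms (φ : Formula) : Finset HomTerm :=
  φ.atoms.biUnion fun
    | .rel _ t _ => {t}
    | .dvd _ _ _ => ∅

/-- The pairs `(d, t)` such that `d ∣ t + c` is a divisibility atom of the formula, for
some `c`. -/
noncomputable def Formula.divAtoms (φ : Formula) : Finset (ℕ × HomTerm) :=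
  φ.atoms.biUnion fun
    | .rel _ _ _ => ∅
    | .dvd d t _ => {(d, t)}

/-- The maximum of `1` and the absolute values of the coefficients in the (in)equations. -/
noncomputable def Formula.maxCoef (φ : Formula) : ℕ :=
  max 1 (φ.atoms.sup fun
    | .rel _ t _ => t.support.sup fun x => (t x).natAbs
    | .dvd _ _ _ => 0)

/-- The maximum of `1` and the absolute values of the constants in the (in)equations. -/
noncomputable def Formula.maxConst (φ : Formula) : ℕ :=
  max 1 (φ.atoms.sup fun
    | .rel _ _ c => c.natAbs
    | .dvd _ _ _ => 0)

/-- The maximum of `1` and the divisors in the divisibility atoms. -/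
noncomputable def Formula.maxDiv (φ : Formula) : ℕ :=
  max 1 (φ.atoms.sup fun
    | .rel _ _ _ => 0
    | .dvd d _ _ => d)

end PA

/-! Formulas are replaced by semantic data. A skeleton records the terms of (in)equations and the
pairs (d, t) of divisibilities, but no constants; `Agree` says that two assignments satisfy the same
atoms over a skeleton, with constants of (in)equations bounded by `C`. A predicate invariant under
`Agree` is a Boolean combination of such atoms (`HasSkeleton.exists_formula`). So only homogeneous
terms are counted: the many offsets and residues met in the elimination merely enlarge `C`.

One variable x is eliminated by `exists_near_guard` and `Agree.exists_update`. A witness may be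
shifted by a common multiple of the divisors as long as no term containing x is close to a constant
in [-C, C]. It can therefore be moved to a place where some term g, with coefficient k > 0 of x, has
a small value u. Solving g = u for x and multiplying by k turns each term t, with coefficient t_x of
x, into k·t - t_x·g, and adds one divisibility by k. The skeleton gains at most one element, and
there are at most |S| + 1 choices of g.

Since ∃ distributes over disjunctions, a family of skeletons is kept throughout a block of equal
quantifiers (`HasFamily`); ∀ is handled by negation. If b quantifiers are eliminated, the skeletons
keep size about n^E while their number reaches about n^(E·b). They are merged into one only at an
alternation, which gives size n^(E·(b+1)): an alternation multiplies the exponent by at most `B + 1`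
(`Formula.Reduces.quant`). Coefficients and divisors go from A to at most A^4 per quantifier;
constants also absorb the period, which is at most A^|S|. -/

namespace PA

/-! ### Values of terms, and terms with prescribed normal form -/

/-- The value of a homogeneous term under an assignment. -/
noncomputable def HomTerm.val (t : HomTerm) (v : ℕ → ℤ) : ℤ := Finsupp.linearCombination ℤ v t

theorem HomTerm.val_update (t : HomTerm) (v : ℕ → ℤ) (x : ℕ) (y : ℤ) :
    HomTerm.val t (Function.update v x y) = HomTerm.val t v + t x * (y - v x) := by
  unfold HomTerm.val
  induction t using Finsupp.induction_linear with
  | zero => simp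
  | add f g hf hg => rw [map_add, map_add, hf, hg, Finsupp.add_apply]; ring
  | single a b =>
    rcases eq_or_ne a x with rfl | h
    · simp; ring
    · simp [h]

theorem Term.eval_eq (t : Term) (v : ℕ → ℤ) : t.eval v = HomTerm.val t.hom v + t.const := by
  unfold HomTerm.val
  induction t with
  | var x => simp [Term.eval, Term.hom, Term.const]
  | zero => simp [Term.eval, Term.hom, Term.const]
  | one => simp [Term.eval, Term.hom, Term.const]
  | neg t ih => simp only [Term.eval, Term.hom, Term.const, ih, map_neg]; ring
  | add t₁ t₂ h₁ h₂ => simp only [Term.eval, Term.hom, Term.const, h₁, h₂, map_add]; ring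

theorem exists_term_const (c : ℤ) : ∃ τ : Term, τ.hom = 0 ∧ τ.const = c := by
  induction c with
  | zero => exact ⟨.zero, rfl, rfl⟩
  | succ i ih =>
    obtain ⟨τ, h₁, h₂⟩ := ih
    exact ⟨.add τ .one, by simp [Term.hom, h₁], by simp [Term.const, h₂]⟩
  | pred i ih =>
    obtain ⟨τ, h₁, h₂⟩ := ih
    exact ⟨.add τ (.neg .one), by simp [Term.hom, h₁], by simp [Term.const, h₂]; ring⟩

theorem exists_term_single (x : ℕ) (k : ℤ) :
    ∃ τ : Term, τ.hom = Finsupp.single x k ∧ τ.const = 0 := by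
  induction k with
  | zero => exact ⟨.zero, by simp [Term.hom], rfl⟩
  | succ i ih =>
    obtain ⟨τ, h₁, h₂⟩ := ih
    exact ⟨.add τ (.var x), by simp [Term.hom, h₁], by simp [Term.const, h₂]⟩
  | pred i ih =>
    obtain ⟨τ, h₁, h₂⟩ := ih
    exact ⟨.add τ (.neg (.var x)), by simp [Term.hom, h₁, sub_eq_add_neg],
      by simp [Term.const, h₂]⟩

theorem exists_term (t : HomTerm) (c : ℤ) : ∃ τ : Term, τ.hom = t ∧ τ.const = c := by
  have key : ∃ τ : Term, τ.hom = t ∧ τ.const = 0 := by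
    induction t using Finsupp.induction_linear with
    | zero => exact exists_term_const 0
    | add f g hf hg =>
      obtain ⟨τ, h₁, h₂⟩ := hf
      obtain ⟨σ, h₃, h₄⟩ := hg
      exact ⟨.add τ σ, by simp [Term.hom, h₁, h₃], by simp [Term.const, h₂, h₄]⟩
    | single x k => exact exists_term_single x k
  obtain ⟨τ, h₁, h₂⟩ := key
  obtain ⟨σ, h₃, h₄⟩ := exists_term_const c
  exact ⟨.add τ σ, by simp [Term.hom, h₁, h₃], by simp [Term.const, h₂, h₄]⟩

/-! ### Skeletons -/

/-- A skeleton collects the pairs `(0, t)` for the terms `t` of (in)equations and the pairs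
`(d, t)` with `d ≠ 0` for the divisibility atoms `d ∣ t + c`. -/
abbrev Skeleton : Type := Finset (ℕ × HomTerm)

/-- Two assignments agree on all atoms with the given skeleton whose (in)equations have
constants bounded by `C`. -/
def Agree (S : Skeleton) (C : ℕ) (v w : ℕ → ℤ) : Prop :=
  ∀ p ∈ S,
    (p.1 = 0 → ∀ c : ℤ, |c| ≤ C →
      (HomTerm.val p.2 v ≤ c ↔ HomTerm.val p.2 w ≤ c) ∧
      (HomTerm.val p.2 v < c ↔ HomTerm.val p.2 w < c)) ∧
    (p.1 ≠ 0 → (p.1 : ℤ) ∣ HomTerm.val p.2 v - HomTerm.val p.2 w)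

theorem Agree.symm {S : Skeleton} {C : ℕ} {v w : ℕ → ℤ} (h : Agree S C v w) : Agree S C w v :=
  fun p hp => ⟨fun h0 c hc => ⟨((h p hp).1 h0 c hc).1.symm, ((h p hp).1 h0 c hc).2.symm⟩,
    fun h0 => by rw [← neg_sub]; exact (dvd_neg).2 ((h p hp).2 h0)⟩

theorem Agree.trans {S : Skeleton} {C : ℕ} {u v w : ℕ → ℤ} (h : Agree S C u v)
    (h' : Agree S C v w) : Agree S C u w :=
  fun p hp => ⟨fun h0 c hc => ⟨((h p hp).1 h0 c hc).1.trans ((h' p hp).1 h0 c hc).1,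
    ((h p hp).1 h0 c hc).2.trans ((h' p hp).1 h0 c hc).2⟩,
    fun h0 => by
      have := dvd_add ((h p hp).2 h0) ((h' p hp).2 h0)
      rwa [sub_add_sub_cancel] at this⟩

theorem Agree.refl (S : Skeleton) (C : ℕ) (v : ℕ → ℤ) : Agree S C v v :=
  fun _ _ => ⟨fun _ _ _ => ⟨Iff.rfl, Iff.rfl⟩, fun _ => by simp⟩

theorem Agree.mono {S S' : Skeleton} {C C' : ℕ} {v w : ℕ → ℤ} (h : Agree S' C' v w)
    (hS : S ⊆ S') (hC : C ≤ C') : Agree S C v w :=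
  fun p hp => ⟨fun h0 c hc => (h p (hS hp)).1 h0 c (hc.trans (by exact_mod_cast hC)),
    (h p (hS hp)).2⟩

/-- All divisors of a skeleton and all coefficients of its (in)equations are at most `A`. -/
def Bounded (S : Skeleton) (A : ℕ) : Prop :=
  ∀ p ∈ S, p.1 ≤ A ∧ (p.1 = 0 → ∀ y, (p.2 y).natAbs ≤ A)

theorem Bounded.mono {S : Skeleton} {A A' : ℕ} (h : Bounded S A) (hA : A ≤ A') : Bounded S A' :=
  fun p hp => ⟨(h p hp).1.trans hA, fun h0 y => ((h p hp).2 h0 y).trans hA⟩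

theorem Bounded.union {S S' : Skeleton} {A : ℕ} (h : Bounded S A) (h' : Bounded S' A) :
    Bounded (S ∪ S') A :=
  fun p hp => (Finset.mem_union.1 hp).elim (h p) (h' p)

/-! ### Eliminating one variable -/

/-- The terms, with positive coefficient of `x`, near whose zeros a witness for `x` is sought. -/
noncomputable def guards (S : Skeleton) (x : ℕ) : Finset HomTerm :=
  insert (Finsupp.single x 1)
    ((S.filter fun p => p.1 = 0 ∧ p.2 x ≠ 0).image fun p => if 0 < p.2 x then p.2 else -p.2)

/-- The skeleton after substituting for `x` the solution of an equation with the term `g`. -/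
noncomputable def substSkeleton (S : Skeleton) (x : ℕ) (g : HomTerm) : Skeleton :=
  insert ((g x).natAbs, g - Finsupp.single x (g x))
    (S.image fun p => ((g x).natAbs * p.1, g x • p.2 - p.2 x • g))

theorem card_guards_le (S : Skeleton) (x : ℕ) : (guards S x).card ≤ S.card + 1 :=
  (Finset.card_insert_le _ _).trans
    (Nat.succ_le_succ (Finset.card_image_le.trans (Finset.card_filter_le _ _)))

theorem card_substSkeleton_le (S : Skeleton) (x : ℕ) (g : HomTerm) :
    (substSkeleton S x g).card ≤ S.card + 1 :=
  (Finset.card_insert_le _ _).trans (Nat.succ_le_succ Finset.card_image_le)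

theorem pos_of_mem_guards {S : Skeleton} {x : ℕ} {g : HomTerm} (hg : g ∈ guards S x) :
    0 < g x := by
  unfold guards at hg
  rw [Finset.mem_insert, Finset.mem_image] at hg
  rcases hg with rfl | ⟨p, hp, rfl⟩
  · simp
  · rw [Finset.mem_filter] at hp
    have := hp.2.2
    split_ifs with h
    · exact h
    · rw [Finsupp.neg_apply]; omega

theorem natAbs_guard_le {S : Skeleton} {x A : ℕ} (hA : 1 ≤ A) (hS : Bounded S A) {g : HomTerm}
    (hg : g ∈ guards S x) (y : ℕ) : (g y).natAbs ≤ A := by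
  unfold guards at hg
  rw [Finset.mem_insert, Finset.mem_image] at hg
  rcases hg with rfl | ⟨p, hp, rfl⟩
  · rw [Finsupp.single_apply]; split_ifs <;> simp [hA]
  · rw [Finset.mem_filter] at hp
    have := (hS p hp.1).2 hp.2.1 y
    split_ifs with h
    · exact this
    · simpa using this

/-- Products of two entries occur, so divisors are at most A² and coefficients at most 2A² ≤ A⁴.
Only coefficients of (in)equations need a bound, since guards come from (in)equations alone; as `g x
> 0`, a pair with divisor 0 can only arise from one. -/
theorem Bounded.subst {S : Skeleton} {x A : ℕ} (hA : 2 ≤ A) (hS : Bounded S A) {g : HomTerm}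
    (hg : g ∈ guards S x) : Bounded (substSkeleton S x g) (A ^ 4) := by
  have h1 : 1 ≤ A := by omega
  have hgA := natAbs_guard_le h1 hS hg
  have h2 : A * A ≤ A ^ 4 := by
    rw [← pow_two]; exact Nat.pow_le_pow_right h1 (by norm_num)
  have h3 : A * A + A * A ≤ A ^ 4 := by
    calc A * A + A * A = 2 * A ^ 2 := by ring
      _ ≤ A ^ 2 * A ^ 2 := Nat.mul_le_mul_right _ (by nlinarith)
      _ = A ^ 4 := by ring
  have hpos := pos_of_mem_guards hg
  intro p hp
  unfold substSkeleton at hp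
  rw [Finset.mem_insert, Finset.mem_image] at hp
  rcases hp with rfl | ⟨p, hp, rfl⟩
  · refine ⟨(hgA x).trans (by nlinarith), fun h0 => ?_⟩
    simp only [Int.natAbs_eq_zero] at h0
    omega
  · refine ⟨(Nat.mul_le_mul (hgA x) (hS p hp).1).trans h2, fun h0 y => ?_⟩
    have h0 : p.1 = 0 := by
      rcases Nat.mul_eq_zero.1 h0 with h | h
      · omega
      · exact h
    have hc := (hS p hp).2 h0
    simp only [Finsupp.coe_sub, Finsupp.coe_smul, Pi.sub_apply, Pi.smul_apply, smul_eq_mul]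
    refine (Int.natAbs_sub_le _ _).trans (le_trans ?_ h3)
    rw [Int.natAbs_mul, Int.natAbs_mul]
    exact Nat.add_le_add (Nat.mul_le_mul (hgA x) (hc y)) (Nat.mul_le_mul (hc x) (hgA y))

/-- A common multiple of the divisors of a skeleton. -/
def period (S : Skeleton) : ℕ := ∏ p ∈ S, max 1 p.1

theorem period_pos (S : Skeleton) : 0 < period S :=
  Finset.prod_pos fun _ _ => by simp

theorem dvd_period {S : Skeleton} {p : ℕ × HomTerm} (hp : p ∈ S) (h0 : p.1 ≠ 0) :
    p.1 ∣ period S := by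
  have := Finset.dvd_prod_of_mem (fun p : ℕ × HomTerm => max 1 p.1) hp
  rwa [show max 1 p.1 = p.1 by omega] at this

/-- This is where the size of the skeleton enters the bound on the constants. -/
theorem period_le {S : Skeleton} {A : ℕ} (hA : 1 ≤ A) (hS : Bounded S A) :
    period S ≤ A ^ S.card :=
  Finset.prod_le_pow_card _ _ _ fun p hp => max_le hA (hS p hp).1

/-- A multiple of the period leaves all residues alone, and a value that moves by less than its
distance to c stays on the same side of c. -/
theorem agree_update_step {S : Skeleton} {C x : ℕ} {v : ℕ → ℤ} {y y' : ℤ} {s : ℤ}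
    (hy : y' = y + s * period S)
    (h : ∀ p ∈ S, p.1 = 0 → ∀ c : ℤ, |c| ≤ C →
      |p.2 x * (s * period S)| < |HomTerm.val p.2 (Function.update v x y) - c| ∨ p.2 x = 0) :
    Agree S C (Function.update v x y) (Function.update v x y') := by
  intro p hp
  have e : HomTerm.val p.2 (Function.update v x y') =
      HomTerm.val p.2 (Function.update v x y) + p.2 x * (s * period S) := by
    rw [HomTerm.val_update, HomTerm.val_update, hy]; ring
  rw [e]
  refine ⟨fun h0 c hc => ?_, fun h0 => ?_⟩
  · rcases h p hp h0 c hc with h | h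
    · generalize p.2 x * (s * period S) = a at *
      generalize HomTerm.val p.2 (Function.update v x y) = b at *
      rcases abs_cases a with ha | ha <;> rcases abs_cases (b - c) with hb | hb <;> omega
    · simp [h]
  · obtain ⟨m, hm⟩ := dvd_period hp h0
    rw [hm]
    exact ⟨-(p.2 x * s * m), by push_cast; ring⟩

/-- Fix an (in)equation term q containing x. While y is far from all guards, a step of one period in
the right direction is harmless and strictly decreases |q|, so the descent must stop near a guard.
-/
theorem exists_near_guard (S : Skeleton) (C x : ℕ) (v : ℕ → ℤ) (y : ℤ) :
    ∃ g ∈ guards S x, ∃ c : ℤ, |c| ≤ C ∧ ∃ y',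
      |HomTerm.val g (Function.update v x y') - c| ≤ g x * period S ∧
      Agree S C (Function.update v x y) (Function.update v x y') := by
  have hδ : (0 : ℤ) < period S := by exact_mod_cast period_pos S
  by_cases hT : ∃ q ∈ S, q.1 = 0 ∧ q.2 x ≠ 0
  · obtain ⟨q, hq, hq0, hqx⟩ := hT
    induction hm : (HomTerm.val q.2 (Function.update v x y)).natAbs using
      Nat.strong_induction_on generalizing y with
    | _ m ih =>
    subst hm
    by_cases hnear : ∃ p ∈ S, (p.1 = 0 ∧ p.2 x ≠ 0) ∧ ∃ c : ℤ, |c| ≤ C ∧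
        |HomTerm.val p.2 (Function.update v x y) - c| ≤ |p.2 x| * period S
    · obtain ⟨p, hp, hp0, c, hc, hle⟩ := hnear
      refine ⟨if 0 < p.2 x then p.2 else -p.2, Finset.mem_insert_of_mem
        (Finset.mem_image.2 ⟨p, Finset.mem_filter.2 ⟨hp, hp0⟩, rfl⟩),
        if 0 < p.2 x then c else -c, ?_, y, ?_, Agree.refl _ _ _⟩
      · split_ifs <;> simpa
      · split_ifs with h
        -- Guards have positive coefficient of x; passing to `-p.2` turns the constant c into -c.
        · rwa [abs_of_pos h] at hle
        · rw [abs_of_nonpos (not_lt.1 h)] at hle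
          rw [Finsupp.neg_apply, HomTerm.val, map_neg, ← neg_sub, abs_neg, sub_neg_eq_add,
            add_comm, ← sub_eq_add_neg, abs_sub_comm]
          simpa [HomTerm.val, abs_sub_comm] using hle
    · push Not at hnear
      have hfar : ∀ s : ℤ, |s| = 1 → ∀ p ∈ S, p.1 = 0 → ∀ c : ℤ, |c| ≤ C →
          |p.2 x * (s * period S)| < |HomTerm.val p.2 (Function.update v x y) - c| ∨
            p.2 x = 0 := by
        intro s hs p hp hp0 c hc
        by_cases hx : p.2 x = 0
        · exact Or.inr hx
        · left
          rw [abs_mul, abs_mul, hs, one_mul, abs_of_pos hδ]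
          exact hnear p hp ⟨hp0, hx⟩ c hc
      have hstep : ∃ s : ℤ, |s| = 1 ∧
          (HomTerm.val q.2 (Function.update v x (y + s * period S))).natAbs <
            (HomTerm.val q.2 (Function.update v x y)).natAbs := by
        have hlt := hnear q hq ⟨hq0, hqx⟩ 0 (by simp)
        have e : ∀ s : ℤ, HomTerm.val q.2 (Function.update v x (y + s * period S)) =
            HomTerm.val q.2 (Function.update v x y) + s * (q.2 x * period S) := by
          intro s; rw [HomTerm.val_update, HomTerm.val_update]; ring
        simp only [e]
        rw [← abs_of_pos hδ, ← abs_mul, sub_zero] at hlt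
        have hne : q.2 x * period S ≠ 0 := mul_ne_zero hqx hδ.ne'
        generalize q.2 x * (period S : ℤ) = a at *
        generalize HomTerm.val q.2 (Function.update v x y) = b at *
        rw [Int.abs_eq_natAbs, Int.abs_eq_natAbs] at hlt
        -- Farness from the constant 0 gives |a| < |b|, so moving b by a towards 0 decreases |b|.
        by_cases hab : (0 < a ↔ 0 < b)
        · exact ⟨-1, by norm_num, by omega⟩
        · exact ⟨1, by norm_num, by omega⟩
      obtain ⟨s, hs, hlt⟩ := hstep
      obtain ⟨g, hg, c, hc, y', h₁, h₂⟩ := ih _ hlt _ rfl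
      exact ⟨g, hg, c, hc, y', h₁, (agree_update_step rfl (hfar s hs)).trans h₂⟩
  -- No (in)equation contains x: only the residue of y matters, and the extra guard x with constant
  -- 0 serves.
  · push Not at hT
    refine ⟨Finsupp.single x 1, Finset.mem_insert_self _ _, 0, by simp, y % period S, ?_, ?_⟩
    · have h1 := Int.emod_nonneg y hδ.ne'
      have h2 := Int.emod_lt_of_pos y hδ
      simp only [HomTerm.val, Finsupp.linearCombination_single, Function.update_self,
        Finsupp.single_eq_same, one_mul, smul_eq_mul, sub_zero]
      rw [abs_of_nonneg h1]
      exact h2.le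
    · refine agree_update_step (s := -(y / period S)) ?_ fun p hp h0 c hc => Or.inr (hT p hp h0)
      have := Int.emod_add_mul_ediv y (period S)
      linarith

/-- The guard depends on v and y only, and works for all w at once. The divisibility by k in the new
skeleton makes g = u solvable for x at w, with the same u as at v; no bound on the number of
possible u is needed. -/
theorem Agree.exists_update {S : Skeleton} {A C C' x : ℕ} (hA : 1 ≤ A) (hS : Bounded S A)
    (hC : A * C + A * (C + A * A ^ S.card) ≤ C') (v : ℕ → ℤ) (y : ℤ) :
    ∃ g ∈ guards S x, ∀ w, Agree (substSkeleton S x g) C' v w →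
      ∃ y', Agree S C (Function.update v x y) (Function.update w x y') := by
  obtain ⟨g, hg, c, hc, z, hz, hag⟩ := exists_near_guard S C x v y
  refine ⟨g, hg, fun w hw => ?_⟩
  have hk := pos_of_mem_guards hg
  have hgA := natAbs_guard_le hA hS hg
  have hkA : |g x| ≤ A := by rw [Int.abs_eq_natAbs]; exact_mod_cast hgA x
  set k := g x with hkdef
  have hnk : ((k.natAbs : ℕ) : ℤ) = k := Int.natAbs_of_nonneg hk.le
  set u := HomTerm.val g (Function.update v x z) with hu
  have hue : u = HomTerm.val g v + k * (z - v x) := HomTerm.val_update g v x z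
  have hdiv := (hw _ (Finset.mem_insert_self _ _)).2 (by simp only; omega)
  simp only at hdiv
  rw [hnk] at hdiv
  have hv1 : ∀ v, HomTerm.val (g - Finsupp.single x k) v = HomTerm.val g v - k * v x := by
    intro v; simp [HomTerm.val]
  rw [hv1, hv1] at hdiv
  obtain ⟨m, hm⟩ := hdiv
  have hwy : HomTerm.val g (Function.update w x (z + m)) = u := by
    rw [HomTerm.val_update, hue]; linarith
  refine ⟨z + m, hag.trans fun p hp => ?_⟩
  have hp' := hw (k.natAbs * p.1, k • p.2 - p.2 x • g)
    (Finset.mem_insert_of_mem (Finset.mem_image.2 ⟨p, hp, rfl⟩))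
  have hv2 : ∀ v, HomTerm.val (k • p.2 - p.2 x • g) v =
      k * HomTerm.val p.2 v - p.2 x * HomTerm.val g v := by
    intro v; simp only [HomTerm.val, map_sub, map_smul, smul_eq_mul]
  simp only [hv2] at hp'
  -- At the solution, k·t is the new term, which is free of x, plus the fixed number t_x·u.
  have key : ∀ (v : ℕ → ℤ) (y : ℤ), HomTerm.val g (Function.update v x y) = u →
      k * HomTerm.val p.2 (Function.update v x y) =
        (k * HomTerm.val p.2 v - p.2 x * HomTerm.val g v) + p.2 x * u := by
    intro v y h
    rw [← h, HomTerm.val_update, HomTerm.val_update]; ring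
  have kv := key v z rfl
  have kw := key w (z + m) hwy
  refine ⟨fun h0 c' hc' => ?_, fun h0 => ?_⟩
  -- The comparison of t with c' becomes one of the new term with this constant; u is within k times
  -- the period of some c in [-C, C].
  · have hb : |k * c' - p.2 x * u| ≤ C' := by
      have hpx : |p.2 x| ≤ A := by
        rw [Int.abs_eq_natAbs]; exact_mod_cast (hS p hp).2 h0 x
      have hper : (period S : ℤ) ≤ (A : ℤ) ^ S.card := by exact_mod_cast period_le hA hS
      have hA0 : (0 : ℤ) ≤ A := by positivity
      have huB : |u| ≤ C + A * (A : ℤ) ^ S.card := by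
        have h1 : |u| ≤ |u - c| + |c| := by simpa using abs_add_le (u - c) c
        have h2 : k * period S ≤ A * (A : ℤ) ^ S.card :=
          mul_le_mul ((le_abs_self k).trans hkA) hper (by positivity) hA0
        linarith
      have hC' : (A : ℤ) * C + A * (C + A * (A : ℤ) ^ S.card) ≤ C' := by exact_mod_cast hC
      refine le_trans (abs_sub _ _) (le_trans (add_le_add ?_ ?_) hC')
      · rw [abs_mul]; exact mul_le_mul hkA hc' (abs_nonneg _) hA0
      · rw [abs_mul]; exact mul_le_mul hpx huB (abs_nonneg _) hA0
    obtain ⟨h1, h2⟩ := hp'.1 (by simp [h0]) _ hb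
    constructor
    · rw [← mul_le_mul_iff_right₀ hk, kv, ← mul_le_mul_iff_right₀ (b := HomTerm.val p.2 _) hk, kw,
        ← le_sub_iff_add_le, ← le_sub_iff_add_le]
      exact h1
    · rw [← mul_lt_mul_iff_right₀ hk, kv, ← mul_lt_mul_iff_right₀ (b := HomTerm.val p.2 _) hk, kw,
        ← lt_sub_iff_add_lt, ← lt_sub_iff_add_lt]
      exact h2
  · have := hp'.2 (Nat.mul_ne_zero (by omega) h0)
    push_cast at this
    rw [← Int.natCast_natAbs, hnk] at this
    refine Int.dvd_of_mul_dvd_mul_left hk.ne' ?_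
    rw [mul_sub, kv, kw, add_sub_add_right_eq_sub]
    exact this

/-! ### Families of skeletons -/

/-- The skeleton `S` determines the truth of `P`. -/
def Determines (S : Skeleton) (C : ℕ) (P : (ℕ → ℤ) → Prop) : Prop :=
  ∀ v w, Agree S C v w → (P v ↔ P w)

/-- Every assignment that satisfies `P` has a whole class of `P`-assignments around it, given by
a skeleton from `F`; that is, `P` is a disjunction of formulas with skeletons from `F`. -/
def Covers (F : Finset Skeleton) (C : ℕ) (P : (ℕ → ℤ) → Prop) : Prop :=
  ∀ v, P v → ∃ S ∈ F, ∀ w, Agree S C v w → P w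

/-- `P` is determined by a bounded skeleton with at most `m` elements. -/
def HasSkeleton (P : (ℕ → ℤ) → Prop) (C A m : ℕ) : Prop :=
  ∃ S : Skeleton, S.card ≤ m ∧ Bounded S A ∧ Determines S C P

/-- `P` is covered by at most `k` bounded skeletons with at most `m` elements each. -/
def HasFamily (P : (ℕ → ℤ) → Prop) (C A k m : ℕ) : Prop :=
  ∃ F : Finset Skeleton, F.Nonempty ∧ F.card ≤ k ∧ (∀ S ∈ F, S.card ≤ m ∧ Bounded S A) ∧
    Covers F C P

section
variable {P P₁ P₂ : (ℕ → ℤ) → Prop} {C C' A A' k k₁ k₂ m m₁ m₂ k' m' : ℕ}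

theorem HasSkeleton.mono (h : HasSkeleton P C A m) (hC : C ≤ C') (hA : A ≤ A') (hm : m ≤ m') :
    HasSkeleton P C' A' m' := by
  obtain ⟨S, h₁, h₂, h₃⟩ := h
  exact ⟨S, h₁.trans hm, h₂.mono hA, fun v w h => h₃ v w (h.mono subset_rfl hC)⟩

theorem HasFamily.mono (h : HasFamily P C A k m) (hC : C ≤ C') (hA : A ≤ A') (hk : k ≤ k')
    (hm : m ≤ m') : HasFamily P C' A' k' m' := by
  obtain ⟨F, h₀, h₁, h₂, h₃⟩ := h
  refine ⟨F, h₀, h₁.trans hk, fun S hS => ⟨(h₂ S hS).1.trans hm, (h₂ S hS).2.mono hA⟩,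
    fun v hv => ?_⟩
  obtain ⟨S, hS, h⟩ := h₃ v hv
  exact ⟨S, hS, fun w hw => h w (hw.mono subset_rfl hC)⟩

theorem HasFamily.congr (h : HasFamily P₁ C A k m) (hP : ∀ v, P₁ v ↔ P₂ v) :
    HasFamily P₂ C A k m := by
  rwa [← funext fun v => propext (hP v)]

theorem HasSkeleton.congr (h : HasSkeleton P₁ C A m) (hP : ∀ v, P₁ v ↔ P₂ v) :
    HasSkeleton P₂ C A m := by
  rwa [← funext fun v => propext (hP v)]

theorem HasSkeleton.not (h : HasSkeleton P C A m) : HasSkeleton (fun v => ¬ P v) C A m := by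
  obtain ⟨S, h₁, h₂, h₃⟩ := h
  exact ⟨S, h₁, h₂, fun v w h => not_congr (h₃ v w h)⟩

theorem HasSkeleton.binary (h₁ : HasSkeleton P₁ C A m₁) (h₂ : HasSkeleton P₂ C A m₂)
    (op : Prop → Prop → Prop) : HasSkeleton (fun v => op (P₁ v) (P₂ v)) C A (m₁ + m₂) := by
  obtain ⟨S, a₁, a₂, a₃⟩ := h₁
  obtain ⟨T, b₁, b₂, b₃⟩ := h₂
  refine ⟨S ∪ T, (Finset.card_union_le _ _).trans (add_le_add a₁ b₁), a₂.union b₂,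
    fun v w h => ?_⟩
  beta_reduce
  rw [propext (a₃ v w (h.mono Finset.subset_union_left le_rfl)),
    propext (b₃ v w (h.mono Finset.subset_union_right le_rfl))]

theorem HasSkeleton.hasFamily (h : HasSkeleton P C A m) : HasFamily P C A 1 m := by
  obtain ⟨S, h₁, h₂, h₃⟩ := h
  exact ⟨{S}, by simp, by simp, by simp [h₁, h₂],
    fun v hv => ⟨S, by simp, fun w hw => (h₃ v w hw).1 hv⟩⟩

/-- The union refines the classes of every member, and symmetry of `Agree` turns preservation of P
into invariance. This merge is the price of an alternation. -/
theorem HasFamily.hasSkeleton (h : HasFamily P C A k m) : HasSkeleton P C A (k * m) := by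
  obtain ⟨F, -, h₁, h₂, h₃⟩ := h
  have key : ∀ v w, Agree (F.biUnion id) C v w → P v → P w := fun v w h hv => by
    obtain ⟨S, hS, hw⟩ := h₃ v hv
    exact hw w (h.mono (Finset.subset_biUnion_of_mem id hS) le_rfl)
  refine ⟨F.biUnion id, ?_, fun p hp => ?_, fun v w h => ⟨key v w h, key w v h.symm⟩⟩
  · exact (Finset.card_biUnion_le_card_mul F id m fun S hS => (h₂ S hS).1).trans
      (Nat.mul_le_mul_right _ h₁)
  · obtain ⟨S, hS, hpS⟩ := Finset.mem_biUnion.1 hp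
    exact (h₂ S hS).2 p hpS

theorem HasFamily.and (h₁ : HasFamily P₁ C A k₁ m₁) (h₂ : HasFamily P₂ C A k₂ m₂) :
    HasFamily (fun v => P₁ v ∧ P₂ v) C A (k₁ * k₂) (m₁ + m₂) := by
  obtain ⟨F, a₀, a₁, a₂, a₃⟩ := h₁
  obtain ⟨G, b₀, b₁, b₂, b₃⟩ := h₂
  refine ⟨Finset.image₂ (· ∪ ·) F G, a₀.image₂ b₀,
    (Finset.card_image₂_le _ _ _).trans (Nat.mul_le_mul a₁ b₁), fun U hU => ?_, fun v hv => ?_⟩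
  · obtain ⟨S, hS, T, hT, rfl⟩ := Finset.mem_image₂.1 hU
    exact ⟨(Finset.card_union_le _ _).trans (add_le_add (a₂ S hS).1 (b₂ T hT).1),
      (a₂ S hS).2.union (b₂ T hT).2⟩
  · obtain ⟨S, hS, h⟩ := a₃ v hv.1
    obtain ⟨T, hT, h'⟩ := b₃ v hv.2
    exact ⟨S ∪ T, Finset.mem_image₂_of_mem hS hT, fun w hw =>
      ⟨h w (hw.mono Finset.subset_union_left le_rfl),
        h' w (hw.mono Finset.subset_union_right le_rfl)⟩⟩

/-- Pairwise unions rather than F ∪ G: two one-element families must again give one element, since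
the count has exponent 0 when there is no quantifier in the leading block. -/
theorem HasFamily.or (h₁ : HasFamily P₁ C A k₁ m₁) (h₂ : HasFamily P₂ C A k₂ m₂) :
    HasFamily (fun v => P₁ v ∨ P₂ v) C A (k₁ * k₂) (m₁ + m₂) := by
  obtain ⟨F, a₀, a₁, a₂, a₃⟩ := h₁
  obtain ⟨G, b₀, b₁, b₂, b₃⟩ := h₂
  refine ⟨Finset.image₂ (· ∪ ·) F G, a₀.image₂ b₀,
    (Finset.card_image₂_le _ _ _).trans (Nat.mul_le_mul a₁ b₁), fun U hU => ?_, fun v hv => ?_⟩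
  · obtain ⟨S, hS, T, hT, rfl⟩ := Finset.mem_image₂.1 hU
    exact ⟨(Finset.card_union_le _ _).trans (add_le_add (a₂ S hS).1 (b₂ T hT).1),
      (a₂ S hS).2.union (b₂ T hT).2⟩
  · rcases hv with hv | hv
    · obtain ⟨S, hS, h⟩ := a₃ v hv
      obtain ⟨T, hT⟩ := b₀
      exact ⟨S ∪ T, Finset.mem_image₂_of_mem hS hT, fun w hw =>
        Or.inl (h w (hw.mono Finset.subset_union_left le_rfl))⟩
    · obtain ⟨T, hT, h⟩ := b₃ v hv
      obtain ⟨S, hS⟩ := a₀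
      exact ⟨S ∪ T, Finset.mem_image₂_of_mem hS hT, fun w hw =>
        Or.inr (h w (hw.mono Finset.subset_union_right le_rfl))⟩

/-- The quantifier acts on each disjunct separately, and each skeleton spawns one successor per
guard: the number is multiplied by m + 1, the size grows only by 1. -/
theorem HasFamily.exists (hA : 2 ≤ A) (h : HasFamily P C A k m) (x : ℕ)
    (hC : A * C + A * (C + A * A ^ m) ≤ C') :
    HasFamily (fun v => ∃ y, P (Function.update v x y)) C' (A ^ 4) (k * (m + 1)) (m + 1) := by
  obtain ⟨F, ⟨S₀, hS₀⟩, a₁, a₂, a₃⟩ := h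
  refine ⟨F.biUnion fun S => (guards S x).image (substSkeleton S x), ?_, ?_, ?_, ?_⟩
  · exact ⟨_, Finset.mem_biUnion.2 ⟨S₀, hS₀, Finset.mem_image_of_mem _
      (Finset.mem_insert_self _ _)⟩⟩
  · refine (Finset.card_biUnion_le_card_mul F _ (m + 1) fun S hS => ?_).trans
      (Nat.mul_le_mul_right _ a₁)
    exact (Finset.card_image_le.trans (card_guards_le S x)).trans
      (Nat.succ_le_succ (a₂ S hS).1)
  · intro U hU
    obtain ⟨S, hS, hU⟩ := Finset.mem_biUnion.1 hU
    obtain ⟨g, hg, rfl⟩ := Finset.mem_image.1 hU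
    exact ⟨(card_substSkeleton_le S x g).trans (Nat.succ_le_succ (a₂ S hS).1),
      (a₂ S hS).2.subst hA hg⟩
  · rintro v ⟨y, hy⟩
    obtain ⟨S, hS, h⟩ := a₃ _ hy
    have hA1 : 1 ≤ A := by omega
    have hle : A * C + A * (C + A * A ^ S.card) ≤ C' :=
      le_trans (by gcongr; exact (a₂ S hS).1) hC
    obtain ⟨g, hg, hw⟩ := Agree.exists_update (x := x) hA1 (a₂ S hS).2 hle v y
    refine ⟨substSkeleton S x g, Finset.mem_biUnion.2 ⟨S, hS, Finset.mem_image_of_mem _ hg⟩,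
      fun w hag => ?_⟩
    obtain ⟨y', hy'⟩ := hw w hag
    exact ⟨y', h _ hy'⟩

end

/-! ### From skeletons back to formulas -/

/-- The atoms of a formula have skeleton `S` and constants bounded by `C`. -/
def Formula.Fits (S : Skeleton) (C : ℕ) (φ : Formula) : Prop :=
  φ.IsQF ∧ ∀ a ∈ φ.atoms, match a with
    | .rel _ t c => (0, t) ∈ S ∧ c.natAbs ≤ C
    | .dvd d t _ => (d, t) ∈ S

theorem Formula.Fits.and {S : Skeleton} {C : ℕ} {φ ψ : Formula} (h : φ.Fits S C)
    (h' : ψ.Fits S C) : (Formula.and φ ψ).Fits S C :=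
  ⟨⟨h.1, h'.1⟩, fun a ha => (Finset.mem_union.1 ha).elim (h.2 a) (h'.2 a)⟩

theorem Formula.Fits.or {S : Skeleton} {C : ℕ} {φ ψ : Formula} (h : φ.Fits S C)
    (h' : ψ.Fits S C) : (Formula.or φ ψ).Fits S C :=
  ⟨⟨h.1, h'.1⟩, fun a ha => (Finset.mem_union.1 ha).elim (h.2 a) (h'.2 a)⟩

theorem Formula.Fits.not {S : Skeleton} {C : ℕ} {φ : Formula} (h : φ.Fits S C) :
    (Formula.not φ).Fits S C := h

theorem exists_fits_rel {S : Skeleton} {C : ℕ} {t : HomTerm} (ht : (0, t) ∈ S) (r : Rel) {c : ℤ}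
    (hc : |c| ≤ C) :
    ∃ ψ : Formula, ψ.Fits S C ∧ ∀ v, ψ.Holds v ↔ r.Holds (HomTerm.val t v) c := by
  obtain ⟨τ, h₁, h₂⟩ := exists_term t 0
  obtain ⟨σ, h₃, h₄⟩ := exists_term 0 c
  refine ⟨.rel r τ σ, ⟨trivial, fun a ha => ?_⟩, fun v => ?_⟩
  · rw [Formula.atoms, Finset.mem_singleton] at ha
    subst ha
    simp only [h₁, h₂, h₃, h₄, sub_zero]
    exact ⟨ht, by rw [Int.abs_eq_natAbs] at hc; exact_mod_cast hc⟩
  · simp only [Formula.Holds, Term.eval_eq, h₁, h₂, h₃, h₄]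
    simp [HomTerm.val]

theorem exists_fits_dvd {S : Skeleton} (C : ℕ) {d : ℕ} {t : HomTerm} (ht : (d, t) ∈ S)
    (hd : 2 ≤ d) (c : ℤ) :
    ∃ ψ : Formula, ψ.Fits S C ∧ ∀ v, ψ.Holds v ↔ (d : ℤ) ∣ HomTerm.val t v + c := by
  obtain ⟨τ, h₁, h₂⟩ := exists_term t c
  refine ⟨.dvd d hd τ, ⟨trivial, fun a ha => ?_⟩, fun v => ?_⟩
  · rw [Formula.atoms, Finset.mem_singleton] at ha
    subst ha
    simp only [h₁]
    exact ht
  · simp only [Formula.Holds, Term.eval_eq, h₁, h₂]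

/-- A predicate whose truth value depends on those of finitely many predicates is a Boolean
combination of them. -/
theorem exists_fits_of_list {S : Skeleton} {C : ℕ} {α : Formula} (hα : α.Fits S C)
    (L : List ((ℕ → ℤ) → Prop))
    (hL : ∀ R ∈ L, ∃ ψ : Formula, ψ.Fits S C ∧ ∀ v, ψ.Holds v ↔ R v) (P : (ℕ → ℤ) → Prop)
    (hP : ∀ v w, (∀ R ∈ L, R v ↔ R w) → (P v ↔ P w)) :
    ∃ ψ : Formula, ψ.Fits S C ∧ ∀ v, ψ.Holds v ↔ P v := by
  induction L generalizing P with
  | nil =>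
    -- P is constant here. The language has no truth constants, so α supplies a tautology and a
    -- contradiction.
    by_cases h : P 0
    · exact ⟨.or α (.not α), hα.or hα.not, fun v =>
        ⟨fun _ => (hP v 0 (by simp)).2 h, fun _ => em _⟩⟩
    · exact ⟨.and α (.not α), hα.and hα.not, fun v =>
        ⟨fun hv => (hv.2 hv.1).elim, fun hv => (h ((hP v 0 (by simp)).1 hv)).elim⟩⟩
  | cons R L ih =>
    have hL' : ∀ R ∈ L, ∃ ψ : Formula, ψ.Fits S C ∧ ∀ v, ψ.Holds v ↔ R v :=
      fun R hR => hL R (List.mem_cons_of_mem _ hR)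
    -- Case distinction on R: the restriction of P to R ↔ B, made invariant under `L` by projection.
    have part : ∀ B : Prop, ∃ ψ : Formula, ψ.Fits S C ∧ ∀ v, ψ.Holds v ↔
        ∃ w, (∀ R ∈ L, R v ↔ R w) ∧ (R w ↔ B) ∧ P w := fun B =>
      ih hL' _ fun v v' h => exists_congr fun w => and_congr_left fun _ =>
        forall₂_congr fun R hR => by rw [propext (h R hR)]
    obtain ⟨ψ₁, f₁, h₁⟩ := part True
    obtain ⟨ψ₀, f₀, h₀⟩ := part False
    obtain ⟨ρ, fρ, hρ⟩ := hL R (by simp)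
    have hR : ∀ (B : Prop) v, (R v ↔ B) →
        ((∃ w, (∀ R ∈ L, R v ↔ R w) ∧ (R w ↔ B) ∧ P w) ↔ P v) := fun B v hv =>
      ⟨fun ⟨w, hw, hB, hPw⟩ => (hP v w fun R' hR' => by
          rcases List.mem_cons.1 hR' with rfl | hR'
          · exact hv.trans hB.symm
          · exact hw R' hR').2 hPw,
        fun h => ⟨v, fun _ _ => Iff.rfl, hv, h⟩⟩
    refine ⟨.or (.and ρ ψ₁) (.and (.not ρ) ψ₀), (fρ.and f₁).or (fρ.not.and f₀), fun v => ?_⟩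
    simp only [Formula.Holds, hρ, h₁, h₀]
    by_cases hv : R v
    · simp only [hv, true_and, not_true, false_and, or_false]
      exact hR True v (by simp [hv])
    · simp only [hv, not_false_eq_true, false_and, true_and, false_or]
      exact hR False v (by simp [hv])

/-- Agreement concerns finitely many atoms: the comparisons with constants in [-C, C], and d ∣ t + c
with 0 ≤ c < d, where c = -t(v) mod d detects the residue of t(v). -/
theorem Determines.exists_fits {S : Skeleton} {C : ℕ} {P : (ℕ → ℤ) → Prop}
    (h : Determines S C P) {α : Formula} (hα : α.Fits S C) :
    ∃ ψ : Formula, ψ.Fits S C ∧ ∀ v, ψ.Holds v ↔ P v := by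
  refine exists_fits_of_list hα
    (((S.filter fun p => p.1 = 0) ×ˢ Finset.Icc (-(C : ℤ)) C).toList.map
        (fun q v => HomTerm.val q.1.2 v ≤ q.2) ++
      ((S.filter fun p => p.1 = 0) ×ˢ Finset.Icc (-(C : ℤ)) C).toList.map
        (fun q v => HomTerm.val q.1.2 v < q.2) ++
      S.toList.flatMap fun p => (List.range p.1).map fun (c : ℕ) v =>
        (p.1 : ℤ) ∣ HomTerm.val p.2 v + (c : ℤ)) ?_ P fun v w hvw => h v w fun p hp => ⟨?_, ?_⟩
  · intro R hR
    simp only [List.mem_append, List.mem_map, Finset.mem_toList, Finset.mem_product,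
      Finset.mem_filter, Finset.mem_Icc, List.mem_flatMap, List.mem_range] at hR
    rcases hR with (⟨⟨⟨d, t⟩, c⟩, ⟨⟨hS, rfl⟩, hc⟩, rfl⟩ | ⟨⟨⟨d, t⟩, c⟩, ⟨⟨hS, rfl⟩, hc⟩, rfl⟩) |
      ⟨⟨d, t⟩, hS, c, hc, rfl⟩
    · exact exists_fits_rel hS .le (abs_le.2 hc)
    · exact exists_fits_rel hS .lt (abs_le.2 hc)
    · by_cases hd : 2 ≤ d
      · exact exists_fits_dvd C hS hd c
      · obtain rfl : d = 1 := by simp only at hc; omega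
        exact ⟨.or α (.not α), hα.or hα.not, fun v => by simpa [Formula.Holds] using em _⟩
  · intro h0 c hc
    have hq : (p, c) ∈ (S.filter fun p => p.1 = 0) ×ˢ Finset.Icc (-(C : ℤ)) C := by
      simpa [hp, h0] using abs_le.1 hc
    exact ⟨hvw _ (List.mem_append_left _ (List.mem_append_left _
        (List.mem_map.2 ⟨(p, c), Finset.mem_toList.2 hq, rfl⟩))),
      hvw _ (List.mem_append_left _ (List.mem_append_right _
        (List.mem_map.2 ⟨(p, c), Finset.mem_toList.2 hq, rfl⟩)))⟩
  · intro h0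
    have hd : (0 : ℤ) < p.1 := by omega
    have h1 := Int.emod_nonneg (-HomTerm.val p.2 v) hd.ne'
    have h2 := Int.emod_lt_of_pos (-HomTerm.val p.2 v) hd
    have hc : ((((-HomTerm.val p.2 v) % p.1).toNat : ℕ) : ℤ) = (-HomTerm.val p.2 v) % p.1 :=
      Int.toNat_of_nonneg h1
    have key := hvw _ (List.mem_append_right _ (List.mem_flatMap.2 ⟨p, Finset.mem_toList.2 hp,
      List.mem_map.2 ⟨((-HomTerm.val p.2 v) % p.1).toNat, List.mem_range.2 (by omega), rfl⟩⟩))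
    simp only [hc] at key
    have hv : (p.1 : ℤ) ∣ HomTerm.val p.2 v + (-HomTerm.val p.2 v) % p.1 := by
      refine Int.dvd_of_emod_eq_zero ?_
      rw [Int.add_emod_emod]; simp
    have := dvd_sub hv (key.1 hv)
    rwa [add_sub_add_right_eq_sub] at this

/-- A predicate determined by a small skeleton is defined by a quantifier-free formula with few
terms. -/
theorem HasSkeleton.exists_formula {P : (ℕ → ℤ) → Prop} {C A m : ℕ} (h : HasSkeleton P C A m)
    (hC : 1 ≤ C) (hA : 1 ≤ A) (hm : 1 ≤ m) :
    ∃ ψ : Formula, ψ.IsQF ∧ (∀ v, P v ↔ ψ.Holds v) ∧ ψ.homTerms.card ≤ m ∧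
      ψ.divAtoms.card ≤ m ∧ ψ.maxCoef ≤ A ∧ ψ.maxDiv ≤ A ∧ ψ.maxConst ≤ C := by
  obtain ⟨S, hS, hB, ψ, hψ, hP⟩ : ∃ S : Skeleton, S.card ≤ m ∧ Bounded S A ∧
      ∃ ψ : Formula, ψ.Fits S C ∧ ∀ v, ψ.Holds v ↔ P v := by
    obtain ⟨S, hS, hB, hD⟩ := h
    by_cases h1 : ∃ p ∈ S, p.1 ≠ 1
    · obtain ⟨⟨d, t⟩, hp, hd⟩ := h1
      refine ⟨S, hS, hB, ?_⟩
      rcases Nat.eq_zero_or_pos d with rfl | h0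
      · obtain ⟨α, hα, -⟩ := exists_fits_rel (C := C) hp .eq (c := 0) (by simp)
        exact hD.exists_fits hα
      · obtain ⟨α, hα, -⟩ := exists_fits_dvd C hp (by simp only at hd; omega) 0
        exact hD.exists_fits hα
    -- Divisor 1 yields no admissible atom. If no other divisor occurs, P is constant, and the
    -- skeleton of 0 = 0 can replace S.
    · push Not at h1
      refine ⟨{(0, 0)}, by simpa using hm, fun p hp => ?_, ?_⟩
      · rw [Finset.mem_singleton] at hp; subst hp; simp
      · obtain ⟨α, hα, -⟩ := exists_fits_rel (S := {(0, 0)}) (C := C) (Finset.mem_singleton_self _)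
          .eq (c := 0) (by simp)
        refine Determines.exists_fits (fun v w _ => hD v w fun p hp => ?_) hα
        simp [h1 p hp]
  refine ⟨ψ, hψ.1, fun v => (hP v).symm, ?_, ?_, ?_, ?_, ?_⟩
  · refine (Finset.card_le_card (t := S.image Prod.snd) fun t ht => ?_).trans
      (Finset.card_image_le.trans hS)
    obtain ⟨a, ha, hta⟩ := Finset.mem_biUnion.1 ht
    have := hψ.2 a ha
    cases a with
    | rel r s c =>
      rw [Finset.mem_singleton] at hta
      subst hta
      exact Finset.mem_image.2 ⟨_, this.1, rfl⟩
    | dvd d s c => simp at hta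
  · refine (Finset.card_le_card (t := S) fun t ht => ?_).trans hS
    obtain ⟨a, ha, hta⟩ := Finset.mem_biUnion.1 ht
    have := hψ.2 a ha
    cases a with
    | rel r s c => simp at hta
    | dvd d s c =>
      rw [Finset.mem_singleton] at hta
      subst hta
      exact this
  · refine max_le hA (Finset.sup_le fun a ha => ?_)
    have := hψ.2 a ha
    cases a with
    | rel r s c => exact Finset.sup_le fun x _ => (hB _ this.1).2 rfl x
    | dvd d s c => exact Nat.zero_le _
  · refine max_le hA (Finset.sup_le fun a ha => ?_)
    have := hψ.2 a ha
    cases a with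
    | rel r s c => exact Nat.zero_le _
    | dvd d s c => exact (hB _ this).1
  · refine max_le hC (Finset.sup_le fun a ha => ?_)
    have := hψ.2 a ha
    cases a with
    | rel r s c => exact this.2
    | dvd d s c => exact Nat.zero_le _

/-! ### Eliminating all quantifiers -/

theorem Quant.dual_dual (Q : Quant) : Q.dual.dual = Q := by cases Q <;> rfl

theorem Quant.eq_or_eq_dual (Q Q' : Quant) : Q' = Q ∨ Q' = Q.dual := by
  cases Q <;> cases Q' <;> simp [Quant.dual]

theorem Formula.qaQ_dual_le (φ : Formula) (Q : Quant) : φ.qaQ Q.dual ≤ φ.qaQ Q + 1 := by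
  induction φ generalizing Q with
  | rel | dvd => exact Nat.zero_le _
  | not φ ih => exact ih Q.dual
  | and φ₁ φ₂ h₁ h₂ | or φ₁ φ₂ h₁ h₂ =>
    have := h₁ Q; have := h₂ Q
    simp only [Formula.qaQ]; omega
  | imp φ₁ φ₂ h₁ h₂ =>
    have := h₁ Q.dual; have := h₂ Q
    simp only [Formula.qaQ]; omega
  | iff φ₁ φ₂ h₁ h₂ =>
    have := h₁ Q.dual; have := h₂ Q; have := h₁ Q; have := h₂ Q.dual
    simp only [Formula.qaQ, Quant.dual_dual] at *; omega
  | quant Q' x φ ih =>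
    have := ih Q; have := ih Q.dual
    cases Q <;> cases Q' <;> simp [Formula.qaQ, Quant.dual] at * <;> omega

theorem Formula.length_pos (φ : Formula) : 1 ≤ φ.length := by
  cases φ <;> simp only [Formula.length] <;> omega

/-- The formula for the quantifier `∃`, its negation for `∀`. -/
def Formula.Mode (φ : Formula) : Quant → (ℕ → ℤ) → Prop
  | .ex, v => φ.Holds v
  | .all, v => ¬ φ.Holds v

theorem Formula.mode_quant_self (Q : Quant) (x : ℕ) (φ : Formula) (v : ℕ → ℤ) :
    (Formula.quant Q x φ).Mode Q v ↔ ∃ y, φ.Mode Q (Function.update v x y) := by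
  cases Q <;> simp [Formula.Mode, Formula.Holds]

theorem hasSkeleton_of_mode {φ : Formula} {Q : Quant} {C A m : ℕ}
    (h : HasSkeleton (φ.Mode Q) C A m) : HasSkeleton φ.Holds C A m := by
  cases Q with
  | ex => exact h
  | all => exact h.not.congr fun v => not_not

theorem HasSkeleton.mode {φ : Formula} {C A m : ℕ} (h : HasSkeleton φ.Holds C A m) (Q : Quant) :
    HasSkeleton (φ.Mode Q) C A m := by
  cases Q with
  | ex => exact h
  | all => exact h.not

/-! ### Numerical estimates -/

/-- The three summands are each at most C₀·A₀^(4u) with u = 8^q·K, and the factor 4 ≤ A₀² fits into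
the remaining exponent. -/
theorem const_bound {A₀ C₀ K m : ℕ} (hA : 2 ≤ A₀) (hC : 1 ≤ C₀) (hK : 1 ≤ K) (hm : m ≤ K)
    (q : ℕ) :
    A₀ ^ 4 ^ q * (C₀ * A₀ ^ (8 ^ q * K)) +
        A₀ ^ 4 ^ q * (C₀ * A₀ ^ (8 ^ q * K) + A₀ ^ 4 ^ q * (A₀ ^ 4 ^ q) ^ m) ≤
      C₀ * A₀ ^ (8 ^ (q + 1) * K) := by
  have h48 : 4 ^ q ≤ 8 ^ q := Nat.pow_le_pow_left (by norm_num) q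
  have h4 : 1 ≤ 4 ^ q := Nat.one_le_pow _ _ (by norm_num)
  generalize 4 ^ q = r at *
  have hs : 8 ^ (q + 1) * K = 8 * (8 ^ q * K) := by ring
  rw [hs]
  generalize hg : 8 ^ q = s at *
  have hA1 : 1 ≤ A₀ := by omega
  have hrK : r * m ≤ s * K := Nat.mul_le_mul h48 hm
  have hsK : s ≤ s * K := Nat.le_mul_of_pos_right _ hK
  generalize s * K = u at *
  have e1 : A₀ ^ r * (C₀ * A₀ ^ u) ≤ C₀ * A₀ ^ (4 * u) := by
    calc A₀ ^ r * (C₀ * A₀ ^ u) = C₀ * A₀ ^ (r + u) := by ring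
      _ ≤ _ := Nat.mul_le_mul_left _ (Nat.pow_le_pow_right hA1 (by omega))
  have e2 : A₀ ^ r * (A₀ ^ r * (A₀ ^ r) ^ m) ≤ C₀ * A₀ ^ (4 * u) := by
    calc A₀ ^ r * (A₀ ^ r * (A₀ ^ r) ^ m) = 1 * A₀ ^ (r + r + r * m) := by ring
      _ ≤ _ := Nat.mul_le_mul hC (Nat.pow_le_pow_right hA1 (by omega))
  have e3 : 4 * (C₀ * A₀ ^ (4 * u)) ≤ C₀ * A₀ ^ (8 * u) := by
    calc 4 * (C₀ * A₀ ^ (4 * u)) = C₀ * (2 ^ 2 * A₀ ^ (4 * u)) := by ring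
      _ ≤ C₀ * (A₀ ^ 2 * A₀ ^ (4 * u)) := by gcongr
      _ = C₀ * A₀ ^ (2 + 4 * u) := by ring
      _ ≤ _ := Nat.mul_le_mul_left _ (Nat.pow_le_pow_right hA1 (by omega))
  rw [mul_add]
  omega

theorem pow_add_pow_le_length {n₁ n₂ E₁ E₂ E : ℕ} (h₁ : 1 ≤ n₁) (h₂ : 1 ≤ n₂) (hE : 1 ≤ E)
    (hE₁ : E₁ ≤ E) (hE₂ : E₂ ≤ E) : n₁ ^ E₁ + n₂ ^ E₂ ≤ (n₁ + 1 + n₂) ^ E :=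
  calc n₁ ^ E₁ + n₂ ^ E₂ ≤ n₁ ^ E + n₂ ^ E :=
        add_le_add (Nat.pow_le_pow_right h₁ hE₁) (Nat.pow_le_pow_right h₂ hE₂)
    _ ≤ (n₁ + n₂) ^ E := pow_add_pow_le (Nat.zero_le _) (Nat.zero_le _) (by omega)
    _ ≤ _ := Nat.pow_le_pow_left (by omega) _

theorem pow_mul_pow_le_length {n₁ n₂ E₁ E₂ E b₁ b₂ : ℕ} (h₁ : 1 ≤ n₁) (h₂ : 1 ≤ n₂)
    (hE₁ : E₁ ≤ E) (hE₂ : E₂ ≤ E) :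
    n₁ ^ (E₁ * b₁) * n₂ ^ (E₂ * b₂) ≤ (n₁ + 1 + n₂) ^ (E * (b₁ + b₂)) := by
  rw [mul_add, pow_add]
  refine Nat.mul_le_mul ?_ ?_
  · exact (Nat.pow_le_pow_right h₁ (Nat.mul_le_mul_right _ hE₁)).trans
      (Nat.pow_le_pow_left (by omega) _)
  · exact (Nat.pow_le_pow_right h₂ (Nat.mul_le_mul_right _ hE₂)).trans
      (Nat.pow_le_pow_left (by omega) _)

/-! ### Induction on the structure of the formula -/

/-- The bounds obtained by eliminating all quantifiers of `φ`, where `B` bounds the quantifier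
block length, `A₀` the coefficients and divisors, and `C₀` the constants. -/
def Formula.Reduces (B K A₀ C₀ : ℕ) (φ : Formula) : Prop :=
  HasSkeleton φ.Holds (C₀ * A₀ ^ (8 ^ φ.qn * K)) (A₀ ^ 4 ^ φ.qn)
    (φ.length ^ (B + 1) ^ (max (φ.qaQ .ex) (φ.qaQ .all) - 1)) ∧
  ∀ Q, HasFamily (φ.Mode Q) (C₀ * A₀ ^ (8 ^ φ.qn * K)) (A₀ ^ 4 ^ φ.qn)
    (φ.length ^ ((B + 1) ^ (φ.qaQ Q - 1) * φ.qblQ Q)) (φ.length ^ (B + 1) ^ (φ.qaQ Q - 1))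

theorem pow_pred_le {B e e' : ℕ} (h : e ≤ e') : (B + 1) ^ (e - 1) ≤ (B + 1) ^ (e' - 1) :=
  Nat.pow_le_pow_right (by omega) (by omega)

section
variable {B K A₀ C₀ : ℕ} {φ φ₁ φ₂ : Formula}

theorem Formula.Reduces.hasSkeleton_binary (hA : 1 ≤ A₀) (h₁ : φ₁.Reduces B K A₀ C₀)
    (h₂ : φ₂.Reduces B K A₀ C₀) (op : Prop → Prop → Prop) {e : ℕ}
    (he₁ : max (φ₁.qaQ .ex) (φ₁.qaQ .all) ≤ e) (he₂ : max (φ₂.qaQ .ex) (φ₂.qaQ .all) ≤ e) :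
    HasSkeleton (fun v => op (φ₁.Holds v) (φ₂.Holds v)) (C₀ * A₀ ^ (8 ^ (φ₁.qn + φ₂.qn) * K))
      (A₀ ^ 4 ^ (φ₁.qn + φ₂.qn)) ((φ₁.length + 1 + φ₂.length) ^ (B + 1) ^ (e - 1)) := by
  refine HasSkeleton.mono (HasSkeleton.binary (h₁.1.mono
    (C' := C₀ * A₀ ^ (8 ^ (φ₁.qn + φ₂.qn) * K)) (A' := A₀ ^ 4 ^ (φ₁.qn + φ₂.qn)) ?_ ?_ le_rfl) (h₂.1.mono ?_ ?_ le_rfl) op) le_rfl le_rfl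
    (pow_add_pow_le_length φ₁.length_pos φ₂.length_pos (Nat.one_le_pow _ _ (by omega))
      (pow_pred_le he₁) (pow_pred_le he₂)) <;> gcongr <;> omega

theorem Formula.Reduces.hasFamily_binary (hA : 1 ≤ A₀) (h₁ : φ₁.Reduces B K A₀ C₀)
    (h₂ : φ₂.Reduces B K A₀ C₀) (Q₁ Q₂ : Quant) :
    HasFamily (fun v => φ₁.Mode Q₁ v ∧ φ₂.Mode Q₂ v) (C₀ * A₀ ^ (8 ^ (φ₁.qn + φ₂.qn) * K))
      (A₀ ^ 4 ^ (φ₁.qn + φ₂.qn))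
      ((φ₁.length + 1 + φ₂.length) ^
        ((B + 1) ^ (max (φ₁.qaQ Q₁) (φ₂.qaQ Q₂) - 1) * (φ₁.qblQ Q₁ + φ₂.qblQ Q₂)))
      ((φ₁.length + 1 + φ₂.length) ^ (B + 1) ^ (max (φ₁.qaQ Q₁) (φ₂.qaQ Q₂) - 1)) ∧
    HasFamily (fun v => φ₁.Mode Q₁ v ∨ φ₂.Mode Q₂ v) (C₀ * A₀ ^ (8 ^ (φ₁.qn + φ₂.qn) * K))
      (A₀ ^ 4 ^ (φ₁.qn + φ₂.qn))
      ((φ₁.length + 1 + φ₂.length) ^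
        ((B + 1) ^ (max (φ₁.qaQ Q₁) (φ₂.qaQ Q₂) - 1) * (φ₁.qblQ Q₁ + φ₂.qblQ Q₂)))
      ((φ₁.length + 1 + φ₂.length) ^ (B + 1) ^ (max (φ₁.qaQ Q₁) (φ₂.qaQ Q₂) - 1)) := by
  have f₁ := (h₁.2 Q₁).mono (C' := C₀ * A₀ ^ (8 ^ (φ₁.qn + φ₂.qn) * K))
    (A' := A₀ ^ 4 ^ (φ₁.qn + φ₂.qn)) (by gcongr <;> omega) (by gcongr <;> omega) le_rfl le_rfl
  have f₂ := (h₂.2 Q₂).mono (C' := C₀ * A₀ ^ (8 ^ (φ₁.qn + φ₂.qn) * K))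
    (A' := A₀ ^ 4 ^ (φ₁.qn + φ₂.qn)) (by gcongr <;> omega) (by gcongr <;> omega) le_rfl le_rfl
  have hk := pow_mul_pow_le_length (b₁ := φ₁.qblQ Q₁) (b₂ := φ₂.qblQ Q₂) φ₁.length_pos
    φ₂.length_pos (pow_pred_le (B := B) (le_max_left (φ₁.qaQ Q₁) (φ₂.qaQ Q₂)))
    (pow_pred_le (B := B) (le_max_right (φ₁.qaQ Q₁) (φ₂.qaQ Q₂)))
  have hm := pow_add_pow_le_length φ₁.length_pos φ₂.length_pos
    (Nat.one_le_pow (max (φ₁.qaQ Q₁) (φ₂.qaQ Q₂) - 1) (B + 1) (by omega))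
    (pow_pred_le (B := B) (le_max_left (φ₁.qaQ Q₁) (φ₂.qaQ Q₂)))
    (pow_pred_le (B := B) (le_max_right (φ₁.qaQ Q₁) (φ₂.qaQ Q₂)))
  exact ⟨(f₁.and f₂).mono le_rfl le_rfl hk hm, (f₁.or f₂).mono le_rfl le_rfl hk hm⟩

theorem Formula.Reduces.not (h : φ.Reduces B K A₀ C₀) : (Formula.not φ).Reduces B K A₀ C₀ := by
  have hn : φ.length ≤ (Formula.not φ).length := by simp [Formula.length]
  refine ⟨?_, fun Q => ?_⟩
  · refine h.1.not.mono le_rfl le_rfl ?_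
    simp only [Formula.qaQ, Quant.dual]
    rw [max_comm]
    exact Nat.pow_le_pow_left hn _
  · refine ((h.2 Q.dual).congr fun v => ?_).mono le_rfl le_rfl (Nat.pow_le_pow_left hn _)
      (Nat.pow_le_pow_left hn _)
    cases Q <;> simp [Formula.Mode, Formula.Holds, Quant.dual]

theorem Formula.Reduces.and (hA : 1 ≤ A₀) (h₁ : φ₁.Reduces B K A₀ C₀)
    (h₂ : φ₂.Reduces B K A₀ C₀) : (Formula.and φ₁ φ₂).Reduces B K A₀ C₀ := by
  refine ⟨h₁.hasSkeleton_binary hA h₂ And ?_ ?_, fun Q => ?_⟩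
  · simp only [Formula.qaQ]; omega
  · simp only [Formula.qaQ]; omega
  · cases Q with
    | ex => exact (h₁.hasFamily_binary hA h₂ .ex .ex).1
    | all => exact (h₁.hasFamily_binary hA h₂ .all .all).2.congr fun v => not_and_or.symm

theorem Formula.Reduces.or (hA : 1 ≤ A₀) (h₁ : φ₁.Reduces B K A₀ C₀)
    (h₂ : φ₂.Reduces B K A₀ C₀) : (Formula.or φ₁ φ₂).Reduces B K A₀ C₀ := by
  refine ⟨h₁.hasSkeleton_binary hA h₂ Or ?_ ?_, fun Q => ?_⟩
  · simp only [Formula.qaQ]; omega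
  · simp only [Formula.qaQ]; omega
  · cases Q with
    | ex => exact (h₁.hasFamily_binary hA h₂ .ex .ex).2
    | all => exact (h₁.hasFamily_binary hA h₂ .all .all).1.congr fun v => not_or.symm

theorem Formula.Reduces.imp (hA : 1 ≤ A₀) (h₁ : φ₁.Reduces B K A₀ C₀)
    (h₂ : φ₂.Reduces B K A₀ C₀) : (Formula.imp φ₁ φ₂).Reduces B K A₀ C₀ := by
  refine ⟨h₁.hasSkeleton_binary hA h₂ (· → ·) ?_ ?_, fun Q => ?_⟩
  · simp only [Formula.qaQ, Quant.dual]; omega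
  · simp only [Formula.qaQ, Quant.dual]; omega
  · cases Q with
    | ex => exact (h₁.hasFamily_binary hA h₂ .all .ex).2.congr fun v => imp_iff_not_or.symm
    | all => exact (h₁.hasFamily_binary hA h₂ .ex .all).1.congr fun v => Classical.not_imp.symm

theorem Formula.Reduces.iff (hA : 1 ≤ A₀) (h₁ : φ₁.Reduces B K A₀ C₀)
    (h₂ : φ₂.Reduces B K A₀ C₀) : (Formula.iff φ₁ φ₂).Reduces B K A₀ C₀ := by
  refine ⟨h₁.hasSkeleton_binary hA h₂ (· ↔ ·) ?_ ?_, fun Q => ?_⟩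
  · simp only [Formula.qaQ, Quant.dual]; omega
  · simp only [Formula.qaQ, Quant.dual]; omega
  -- Both polarities of both sides enter the alternation count of ↔, so one merged skeleton already
  -- meets the bound, without splitting into two implications.
  · have key : HasSkeleton (Formula.iff φ₁ φ₂).Holds _ _ _ :=
      h₁.hasSkeleton_binary hA h₂ (· ↔ ·) (e := (Formula.iff φ₁ φ₂).qaQ Q)
        (by cases Q <;> simp only [Formula.qaQ, Quant.dual] <;> omega)
        (by cases Q <;> simp only [Formula.qaQ, Quant.dual] <;> omega)
    exact (key.mode Q).hasFamily.mono le_rfl le_rfl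
      (Nat.one_le_pow _ _ (Formula.length_pos _)) le_rfl

theorem Formula.Reduces.quant (hA : 2 ≤ A₀) (hC : 1 ≤ C₀) (h : φ.Reduces B K A₀ C₀) (Q : Quant)
    (x : ℕ) (hB : 1 + φ.qblQ Q ≤ B) (hK : φ.length ^ (B + 1) ^ (φ.qaQ Q - 1) ≤ K) :
    (Formula.quant Q x φ).Reduces B K A₀ C₀ := by
  -- Counts 0 and 1 give the same exponent because of the truncated `- 1`.
  set e := max 1 (φ.qaQ Q) with he
  have hQ : (Formula.quant Q x φ).qaQ Q = e := Formula.qaQ_quant_self x φ Q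
  have hQ' : (Formula.quant Q x φ).qaQ Q.dual = 1 + e := by
    cases Q <;> simp [Formula.qaQ, Quant.dual, he]
  have hb : (Formula.quant Q x φ).qblQ Q = 1 + φ.qblQ Q := by simp [Formula.qblQ]
  have hmax : max ((Formula.quant Q x φ).qaQ .ex) ((Formula.quant Q x φ).qaQ .all) = 1 + e := by
    cases Q <;> simp only [Quant.dual] at hQ' <;> omega
  have hE : (B + 1) ^ (φ.qaQ Q - 1) = (B + 1) ^ (e - 1) := by congr 1; omega
  have hE1 : 1 ≤ (B + 1) ^ (e - 1) := Nat.one_le_pow _ _ (by omega)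
  have hn := φ.length_pos
  have hK1 : 1 ≤ K := (Nat.one_le_pow _ _ hn).trans hK
  have hA4 : 2 ≤ A₀ ^ 4 ^ φ.qn := by
    calc 2 ≤ A₀ ^ 1 := by simpa using hA
      _ ≤ _ := Nat.pow_le_pow_right (by omega) (Nat.one_le_pow _ _ (by norm_num))
  have fam := (HasFamily.exists hA4 (h.2 Q) x (const_bound hA hC hK1 hK φ.qn)).congr
    fun v => (Formula.mode_quant_self Q x φ v).symm
  rw [hE] at fam
  have hlen : (Formula.quant Q x φ).length = 2 + φ.length := rfl
  have hqn : (Formula.quant Q x φ).qn = φ.qn + 1 := Nat.add_comm _ _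
  have hm : φ.length ^ (B + 1) ^ (e - 1) + 1 ≤ (2 + φ.length) ^ (B + 1) ^ (e - 1) := by
    have := pow_add_pow_le_length hn le_rfl hE1 (le_refl _) (le_refl ((B + 1) ^ (e - 1)))
    rwa [one_pow, show φ.length + 1 + 1 = 2 + φ.length by ring] at this
  have hk : φ.length ^ ((B + 1) ^ (e - 1) * φ.qblQ Q) * (φ.length ^ (B + 1) ^ (e - 1) + 1) ≤
      (2 + φ.length) ^ ((B + 1) ^ (e - 1) * (1 + φ.qblQ Q)) := by
    rw [mul_add ((B + 1) ^ (e - 1)), mul_one, pow_add, mul_comm]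
    exact Nat.mul_le_mul hm (Nat.pow_le_pow_left (by omega) _)
  have fam' : HasFamily ((Formula.quant Q x φ).Mode Q)
      (C₀ * A₀ ^ (8 ^ (Formula.quant Q x φ).qn * K)) (A₀ ^ 4 ^ (Formula.quant Q x φ).qn)
      ((2 + φ.length) ^ ((B + 1) ^ (e - 1) * (1 + φ.qblQ Q)))
      ((2 + φ.length) ^ (B + 1) ^ (e - 1)) := by
    refine fam.mono (by rw [hqn]) ?_ hk hm
    rw [hqn, pow_succ 4, pow_mul]
  have sk : HasSkeleton (Formula.quant Q x φ).Holds
      (C₀ * A₀ ^ (8 ^ (Formula.quant Q x φ).qn * K)) (A₀ ^ 4 ^ (Formula.quant Q x φ).qn)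
      ((2 + φ.length) ^ (B + 1) ^ (1 + e - 1)) := by
    refine (hasSkeleton_of_mode fam'.hasSkeleton).mono le_rfl le_rfl ?_
    -- Number times size: the exponent is E·(b + 2) for a block of b + 1 ≤ B quantifiers, hence at
    -- most E·(B + 1).
    rw [← pow_add]
    refine Nat.pow_le_pow_right (by omega) ?_
    calc (B + 1) ^ (e - 1) * (1 + φ.qblQ Q) + (B + 1) ^ (e - 1)
        = (B + 1) ^ (e - 1) * (1 + φ.qblQ Q + 1) := by ring
      _ ≤ (B + 1) ^ (e - 1) * (B + 1) := Nat.mul_le_mul_left _ (by omega)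
      _ = (B + 1) ^ (1 + e - 1) := by rw [← pow_succ]; congr 1; omega
  refine ⟨by rwa [hmax, hlen], fun Q' => ?_⟩
  rcases Q.eq_or_eq_dual Q' with rfl | rfl
  · rwa [hQ, hb, hlen]
  · rw [hQ', hlen]
    -- For the dual quantifier the block length is 0, so the family must be a single skeleton.
    exact (sk.mode _).hasFamily.mono le_rfl le_rfl (Nat.one_le_pow _ _ (by omega)) le_rfl

theorem reduces_of_hasSkeleton (hq : φ.qn = 0) (hA : 1 ≤ A₀)
    (h : HasSkeleton φ.Holds C₀ A₀ 1) : φ.Reduces B K A₀ C₀ := by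
  have h' : HasSkeleton φ.Holds (C₀ * A₀ ^ (8 ^ φ.qn * K)) (A₀ ^ 4 ^ φ.qn) 1 := by
    refine h.mono (Nat.le_mul_of_pos_right _ (Nat.pow_pos hA)) ?_ le_rfl
    simp [hq]
  exact ⟨h'.mono le_rfl le_rfl (Nat.one_le_pow _ _ φ.length_pos), fun Q =>
    (h'.mode Q).hasFamily.mono le_rfl le_rfl (Nat.one_le_pow _ _ φ.length_pos)
      (Nat.one_le_pow _ _ φ.length_pos)⟩

end

/-- `L` bounds the alternations for both leading quantifiers, so that one K dominates the skeleton
sizes of all subformulas. -/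
theorem Formula.reduces {B K L A₀ C₀ : ℕ} (hA : 2 ≤ A₀) (hC : 1 ≤ C₀) (φ : Formula)
    (hB : ∀ ψ ∈ φ.subformulas, ∀ Q, ψ.qblQ Q ≤ B) (hL : ∀ Q, φ.qaQ Q ≤ L)
    (hK : φ.length ^ (B + 1) ^ (L - 1) ≤ K)
    (hat : ∀ a ∈ φ.atoms, match a with
      | .rel _ t c => (∀ y, (t y).natAbs ≤ A₀) ∧ c.natAbs ≤ C₀
      | .dvd d _ _ => d ≤ A₀) :
    φ.Reduces B K A₀ C₀ := by
  have hA1 : 1 ≤ A₀ := by omega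
  have hself : ∀ ψ : Formula, ψ ∈ ψ.subformulas := fun ψ => by
    cases ψ <;> simp [Formula.subformulas]
  have hlen : ∀ {n n' : ℕ}, n ≤ n' → n' ^ (B + 1) ^ (L - 1) ≤ K → n ^ (B + 1) ^ (L - 1) ≤ K :=
    fun h h' => (Nat.pow_le_pow_left h _).trans h'
  induction φ with
  | rel r t₁ t₂ =>
    have hat := hat _ (Finset.mem_singleton_self _)
    refine reduces_of_hasSkeleton rfl hA1 ⟨{(0, t₁.hom - t₂.hom)}, by simp, fun p hp => ?_,
      fun v w h => ?_⟩
    · rw [Finset.mem_singleton] at hp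
      subst hp
      exact ⟨Nat.zero_le _, fun _ => hat.1⟩
    · have hc : |t₂.const - t₁.const| ≤ C₀ := by
        rw [Int.abs_eq_natAbs]; exact_mod_cast hat.2
      obtain ⟨h1, h2⟩ := (h _ (Finset.mem_singleton_self _)).1 rfl _ hc
      simp only [HomTerm.val, map_sub] at h1 h2
      simp only [Formula.Holds, Term.eval_eq, HomTerm.val]
      cases r <;> simp only [Rel.Holds] <;> omega
  | dvd d hd t =>
    have hat := hat _ (Finset.mem_singleton_self _)
    refine reduces_of_hasSkeleton rfl hA1 ⟨{(d, t.hom)}, by simp, fun p hp => ?_,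
      fun v w h => ?_⟩
    · rw [Finset.mem_singleton] at hp
      subst hp
      exact ⟨hat, fun h => by simp only at h; omega⟩
    · have := (h _ (Finset.mem_singleton_self _)).2 (by simp only; omega)
      simp only [Formula.Holds, Term.eval_eq]
      exact Int.dvd_iff_dvd_of_dvd_sub (by rw [add_sub_add_right_eq_sub]; exact this)
  | not φ ih =>
    refine (ih (fun ψ hψ => hB ψ (Finset.mem_insert_of_mem hψ)) (fun Q => ?_)
      (hlen (by simp [Formula.length]) hK) hat).not
    have := hL Q.dual
    rwa [Formula.qaQ, Quant.dual_dual] at this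
  | and φ₁ φ₂ h₁ h₂ | or φ₁ φ₂ h₁ h₂ | imp φ₁ φ₂ h₁ h₂ | iff φ₁ φ₂ h₁ h₂ =>
    have hq : ∀ Q, φ₁.qaQ Q ≤ L ∧ φ₂.qaQ Q ≤ L := fun Q => by
      have a := hL Q
      have b := hL Q.dual
      simp only [Formula.qaQ, Quant.dual_dual] at a b
      omega
    have r₁ := h₁ (fun ψ hψ => hB ψ (Finset.mem_insert_of_mem (Finset.mem_union_left _ hψ)))
      (fun Q => (hq Q).1) (hlen (by simp only [Formula.length]; omega) hK)
      (fun a ha => hat a (Finset.mem_union_left _ ha))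
    have r₂ := h₂ (fun ψ hψ => hB ψ (Finset.mem_insert_of_mem (Finset.mem_union_right _ hψ)))
      (fun Q => (hq Q).2) (hlen (by simp only [Formula.length]; omega) hK)
      (fun a ha => hat a (Finset.mem_union_right _ ha))
    first
      | with_reducible exact r₁.and hA1 r₂
      | with_reducible exact r₁.or hA1 r₂
      | with_reducible exact r₁.imp hA1 r₂
      | with_reducible exact r₁.iff hA1 r₂
  | quant Q x φ ih =>
    have hq : ∀ Q', φ.qaQ Q' ≤ L := fun Q' => by
      have a := hL Q.dual
      have b : (Formula.quant Q x φ).qaQ Q.dual = 1 + max 1 (φ.qaQ Q) := by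
        cases Q <;> simp [Formula.qaQ, Quant.dual]
      have c := φ.qaQ_dual_le Q
      rcases Q.eq_or_eq_dual Q' with rfl | rfl <;> omega
    have hl : φ.length ^ (B + 1) ^ (L - 1) ≤ K := hlen (by simp [Formula.length]) hK
    refine (ih (fun ψ hψ => hB ψ (Finset.mem_insert_of_mem hψ)) hq hl hat).quant hA hC Q x ?_ ?_
    · have := hB _ (hself _) Q
      simpa [Formula.qblQ] using this
    · exact (Nat.pow_le_pow_right φ.length_pos (pow_pred_le (hq Q))).trans hl

/-! ### Initial bounds and the final estimate -/

theorem Formula.atoms_bounded (φ : Formula) : ∀ a ∈ φ.atoms, match a with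
    | .rel _ t c => (∀ y, (t y).natAbs ≤ max 2 (max φ.maxCoef φ.maxDiv)) ∧
        c.natAbs ≤ max 2 φ.maxConst
    | .dvd d _ _ => d ≤ max 2 (max φ.maxCoef φ.maxDiv) := by
  intro a ha
  have h1 := Finset.sup_le_iff.1 (max_le_iff.1 (le_refl φ.maxCoef)).2 a ha
  have h2 := Finset.sup_le_iff.1 (max_le_iff.1 (le_refl φ.maxConst)).2 a ha
  have h3 := Finset.sup_le_iff.1 (max_le_iff.1 (le_refl φ.maxDiv)).2 a ha
  cases a with
  | rel r t c =>
    refine ⟨fun y => ?_, h2.trans (le_max_right _ _)⟩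
    by_cases hy : t y = 0
    · simp [hy]
    · refine le_trans ?_ ((h1.trans (le_max_left _ _)).trans (le_max_right _ _))
      exact Finset.le_sup (f := fun x => (t x).natAbs) (Finsupp.mem_support_iff.2 hy)
  | dvd d t c => exact (h3.trans (le_max_right _ _)).trans (le_max_right _ _)

theorem Formula.qblQ_le_qbl {φ ψ : Formula} (h : ψ ∈ φ.subformulas) (Q : Quant) :
    ψ.qblQ Q ≤ φ.qbl := by
  have := Finset.le_sup (f := fun ψ : Formula => max (ψ.qblQ .ex) (ψ.qblQ .all)) h
  refine le_trans ?_ this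
  cases Q <;> simp

end PA

theorem mainTheorem3 (φ : PA.Formula) (n : ℕ) (hn : φ.length = n) :
    ∃ ψ : PA.Formula, ψ.IsQF ∧ φ.Equivalent ψ ∧
      ψ.homTerms.card ≤ n ^ ((φ.qbl + 1) ^ φ.qa) ∧
      ψ.divAtoms.card ≤ n ^ (1 + (φ.qbl + 1) ^ (φ.qa + 2)) ∧
      ∀ a b : ℝ,
        max 2 (max (φ.maxCoef : ℝ) (φ.maxDiv : ℝ)) < a →
        max 2 (φ.maxConst : ℝ) < b →
        (ψ.maxCoef : ℝ) < a ^ (2 ^ (2 * φ.qn)) ∧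
        (ψ.maxDiv : ℝ) < a ^ (2 ^ (2 * φ.qn)) ∧
        (ψ.maxConst : ℝ) <
          b * a ^ (2 ^ (3 * φ.qn) * n ^ (1 + (φ.qbl + 1) ^ (φ.qa + 2))) := by
  subst hn
  have hlen := φ.length_pos
  set B := φ.qbl with hBdef
  set A₀ := max 2 (max φ.maxCoef φ.maxDiv) with hA₀
  set C₀ := max 2 φ.maxConst with hC₀
  set K := φ.length ^ (1 + (B + 1) ^ (φ.qa + 2)) with hKdef
  have hA : 2 ≤ A₀ := le_max_left _ _
  have hC : 2 ≤ C₀ := le_max_left _ _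
  obtain ⟨Q, hQ⟩ : ∃ Q, φ.qaQ Q = φ.qa := by
    rcases min_choice (φ.qaQ .ex) (φ.qaQ .all) with h | h
    · exact ⟨.ex, h.symm⟩
    · exact ⟨.all, h.symm⟩
  have hL : ∀ Q', φ.qaQ Q' ≤ φ.qa + 1 := fun Q' => by
    rw [← hQ]
    rcases Q.eq_or_eq_dual Q' with rfl | rfl
    · exact Nat.le_succ _
    · exact φ.qaQ_dual_le Q
  have hexp : (B + 1) ^ φ.qa ≤ (B + 1) ^ (φ.qa + 2) := Nat.pow_le_pow_right (by omega) (by omega)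
  have hK : φ.length ^ (B + 1) ^ (φ.qa + 1 - 1) ≤ K :=
    Nat.pow_le_pow_right hlen (by rw [Nat.add_sub_cancel]; omega)
  have red := PA.Formula.reduces hA (by omega) φ (fun ψ hψ Q => PA.Formula.qblQ_le_qbl hψ Q) hL hK
    φ.atoms_bounded
  have sk : PA.HasSkeleton φ.Holds (C₀ * A₀ ^ (8 ^ φ.qn * K)) (A₀ ^ 4 ^ φ.qn)
      (φ.length ^ (B + 1) ^ φ.qa) := by
    -- For `qa = 0` the truncated exponent is not a factor `B + 1` below the target, so merging the
    -- family would be too costly; the skeleton bound is used directly.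
    rcases Nat.eq_zero_or_pos φ.qa with h0 | h0
    · refine red.1.mono le_rfl le_rfl (Nat.pow_le_pow_right hlen ?_)
      have := hL .ex
      have := hL .all
      rw [h0, show max (φ.qaQ .ex) (φ.qaQ .all) - 1 = 0 by omega]
    · refine (PA.hasSkeleton_of_mode (red.2 Q).hasSkeleton).mono le_rfl le_rfl ?_
      rw [← pow_add, hQ]
      refine Nat.pow_le_pow_right hlen ?_
      have hb : φ.qblQ Q ≤ B :=
        PA.Formula.qblQ_le_qbl (by cases φ <;> simp [PA.Formula.subformulas]) Q
      calc (B + 1) ^ (φ.qa - 1) * φ.qblQ Q + (B + 1) ^ (φ.qa - 1)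
          = (B + 1) ^ (φ.qa - 1) * (φ.qblQ Q + 1) := by ring
        _ ≤ (B + 1) ^ (φ.qa - 1) * (B + 1) := Nat.mul_le_mul_left _ (by omega)
        _ = (B + 1) ^ φ.qa := by rw [← pow_succ]; congr 1; omega
  obtain ⟨ψ, hqf, heq, hT, hD, hcoef, hdiv, hconst⟩ := sk.exists_formula
    (Nat.mul_pos (by omega) (Nat.pow_pos (by omega))) (Nat.pow_pos (by omega))
    (Nat.one_le_pow _ _ hlen)
  refine ⟨ψ, hqf, heq, hT, hD.trans (Nat.pow_le_pow_right hlen (by omega)),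
    fun a b ha hb => ?_⟩
  have ha' : (A₀ : ℝ) < a := by rw [hA₀]; push_cast; exact ha
  have hb' : (C₀ : ℝ) < b := by rw [hC₀]; push_cast; exact hb
  have h4 : 2 ^ (2 * φ.qn) = 4 ^ φ.qn := by rw [pow_mul]; norm_num
  have h8 : 2 ^ (3 * φ.qn) = 8 ^ φ.qn := by rw [pow_mul]; norm_num
  have hpow : ((A₀ ^ 4 ^ φ.qn : ℕ) : ℝ) < a ^ 2 ^ (2 * φ.qn) := by
    rw [h4]
    push_cast
    exact pow_lt_pow_left₀ ha' (by positivity) (by positivity)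
  refine ⟨(Nat.cast_le.2 hcoef).trans_lt hpow, (Nat.cast_le.2 hdiv).trans_lt hpow,
    (Nat.cast_le.2 hconst).trans_lt ?_⟩
  rw [h8, Nat.cast_mul, Nat.cast_pow]
  refine mul_lt_mul hb' (pow_le_pow_left₀ (by positivity) ha'.le _) ?_ ?_
  · have : (0 : ℝ) < A₀ := by exact_mod_cast (by omega : 0 < A₀)
    positivity
  · exact (lt_of_le_of_lt (by positivity) hb').le
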